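/- Let $\mathcal{O}$ be a henselian discrete valuation ring with field of fractions $K$ and let $\varpi$ be a prime element of $\mathcal{O}$. For $\nu=1,2$ let $A_\nu$ be a (finite-dimensional) central simple $K$-algebra and let $\mathcal{A}_\nu\subseteq A_\nu$ be a hereditary $\mathcal{O}$-order, i.e. an $\mathcal{O}$-subalgebra of $A_\nu$ that is finitely generated as an $\mathcal{O}$-module, spans $A_\nu$ over $K$, and all of whose left ideals are projective. The following conditions are equivalent: (i) $\mathcal{A}_1$ and $\mathcal{A}_2$ are Morita equivalent over $\mathcal{O}$, i.e. there exist an $\mathcal{A}_1$-$\mathcal{A}_2$-bimodule $\mathcal{I}$ and an $\mathcal{A}_2$-$\mathcal{A}_1$-bimodule $\mathcal{J}$ (on each of which the two $\mathcal{O}$-actions coincide) together with bimodule isomorphisms $\mathcal{I}\otimes_{\mathcal{A}_2}\mathcal{J}\cong\mathcal{A}_1$ and $\mathcal{J}\otimes_{\mathcal{A}_1}\mathcal{I}\cong\mathcal{A}_2$. (ii) $A_1$ and $A_2$ are Brauer equivalent over $K$, and $\mathcal{A}_1$ and $\mathcal{A}_2$ have the same index; here the index of $\mathcal{A}_\nu$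 is the positive integer $e$ such that $\mathfrak{P}_\nu^{\,e}=\varpi\mathcal{A}_\nu$, where $\mathfrak{P}_\nu$ is the Jacobson radical of $\mathcal{A}_\nu$. -/

import Mathlib

open scoped TensorProduct

universe u v w

namespace HereditaryOrders

/-- `I` is an `A`-`B`-bimodule over the commutative ring `O`: a left `A`-module and a right
`B`-module (that is, a left module over `Bᵐᵒᵖ`) whose two actions commute with each other and are
both compatible with one and the same `O`-module structure. -/
structure IsBimodule (O A B I : Type*) [CommRing O] [Ring A] [Algebra O A] [Ring B] [Algebra O B]
    [AddCommGroup I] [Module O I] [Module A I] [Module Bᵐᵒᵖ I] : Prop where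
  left_compat : IsScalarTower O A I
  right_compat : IsScalarTower O Bᵐᵒᵖ I
  comm : SMulCommClass A Bᵐᵒᵖ I

/-- The relations `(i b) ⊗ j = i ⊗ (b j)` that cut out `I ⊗_B J` from `I ⊗_O J`. -/
def balancedRel (O B I J : Type*) [CommRing O] [Ring B]
    [AddCommGroup I] [Module O I] [Module Bᵐᵒᵖ I]
    [AddCommGroup J] [Module O J] [Module B J] : Submodule O (I ⊗[O] J) :=
  Submodule.span O
    {x | ∃ (i : I) (b : B) (j : J), x = (MulOpposite.op b • i) ⊗ₜ[O] j - i ⊗ₜ[O] (b • j)}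

/-- The tensor product `I ⊗_B J` of a right `B`-module `I` and a left `B`-module `J` over the
(not necessarily commutative) `O`-algebra `B`. -/
abbrev BalancedTensor (O B I J : Type*) [CommRing O] [Ring B]
    [AddCommGroup I] [Module O I] [Module Bᵐᵒᵖ I]
    [AddCommGroup J] [Module O J] [Module B J] : Type _ :=
  (I ⊗[O] J) ⧸ balancedRel O B I J

/-- The class of `i ⊗ j` in `I ⊗_B J`. -/
def balancedTmul (O B : Type*) {I J : Type*} [CommRing O] [Ring B]
    [AddCommGroup I] [Module O I] [Module Bᵐᵒᵖ I]
    [AddCommGroup J] [Module O J] [Module B J] (i : I) (j : J) : BalancedTensor O B I J :=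
  Submodule.Quotient.mk (i ⊗ₜ[O] j)

/-- For an `A`-`B`-bimodule `I` and a `B`-`A`-bimodule `J`: there is an isomorphism of
`A`-`A`-bimodules `I ⊗_B J ≅ A`. As the map is additive and the elements `i ⊗ j` generate
`I ⊗_B J`, compatibility with the two `A`-actions is stated on these elements. -/
def HasBimoduleIso (O A B I J : Type*) [CommRing O] [Ring A] [Algebra O A] [Ring B]
    [AddCommGroup I] [Module O I] [Module A I] [Module Bᵐᵒᵖ I]
    [AddCommGroup J] [Module O J] [Module B J] [Module Aᵐᵒᵖ J] : Prop :=
  ∃ f : BalancedTensor O B I J ≃ₗ[O] A, ∀ (a : A) (i : I) (j : J),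
    f (balancedTmul O B (a • i) j) = a * f (balancedTmul O B i j) ∧
    f (balancedTmul O B i (MulOpposite.op a • j)) = f (balancedTmul O B i j) * a

/-- The `O`-algebras `A` and `B` are Morita equivalent: there are an `A`-`B`-bimodule `I` and a
`B`-`A`-bimodule `J` with bimodule isomorphisms `I ⊗_B J ≅ A` and `J ⊗_A I ≅ B`.
(Such `I` and `J` are finitely generated over `A` and `B`, so that the universe is no
restriction.) -/
def MoritaEquivalent (O : Type u) (A : Type v) (B : Type w) [CommRing O] [Ring A] [Algebra O A]
    [Ring B] [Algebra O B] : Prop :=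
  ∃ (I J : Type (max v w))
    (_ : AddCommGroup I) (_ : Module O I) (_ : Module A I) (_ : Module Bᵐᵒᵖ I)
    (_ : AddCommGroup J) (_ : Module O J) (_ : Module B J) (_ : Module Aᵐᵒᵖ J),
    IsBimodule O A B I ∧ IsBimodule O B A J ∧
      HasBimoduleIso O A B I J ∧ HasBimoduleIso O B A J I

/-- The subring `𝒜` is a hereditary `O`-order in the `K`-algebra `A`: it is a finitely generated
`O`-module, it spans `A` over `K`, and each of its left ideals is projective. -/
structure IsHereditaryOrder {O : Type*} (K : Type*) {A : Type*} [CommRing O] [Field K] [Ring A]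
    [Algebra O A] [Algebra K A] (𝒜 : Subalgebra O A) : Prop where
  fg : (Subalgebra.toSubmodule 𝒜).FG
  span_eq_top : Submodule.span K (𝒜 : Set A) = ⊤
  projective_left_ideal : ∀ L : Ideal 𝒜, Module.Projective 𝒜 L

/-- The positive integer `e` is the index of the `O`-algebra `R` with respect to the prime
element `ϖ` of `O`: `𝔓 ^ e = ϖ R`, where `𝔓` is the Jacobson radical of `R`. -/
def IsIndex {O : Type*} (R : Type*) [CommRing O] [Ring R] [Algebra O R] (ϖ : O) (e : ℕ) : Prop :=
  0 < e ∧ Ring.jacobson R ^ e = Ideal.span {algebraMap O R ϖ}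

end HereditaryOrders

/-!
The order `𝒜` in `A` is studied through its lattices: the nonzero finitely generated
`𝒜`-submodules of the simple `A`-module `V`. Let `D` be the endomorphism ring of `V`, a division
algebra.

*Lattices form a chain* (`IsLatticeModule.le_total`). Lattices are projective, as `𝒜` is hereditary.
The endomorphism ring of a lattice consists of elements of `D` that are integral over `O`; as `O` is
henselian, the minimal polynomial `g` of such an element has a reduction that is a power of an
irreducible polynomial, so that `g 0` or `g 1` is a unit (`isUnit_eval_of_irreducible`). Hence
lattices are indecomposable in the strong sense of `exists_smul_eq_or`, and the sum `L + M` of two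
lattices, being projective and thus a direct summand of `L ⊕ M`, is equal to `L` or to `M`.

*The index* (`IsLatticeModule.exists_isIndex`). In the chain, the successor of `M` downwards is
`𝔓 M`, where `𝔓` is the Jacobson radical of `𝒜`. So `ϖ M = 𝔓 ^ e M` for some `e`, which does not
depend on `M`, and then `𝔓 ^ e = ϖ 𝒜`. Every lattice has the form `d 𝔓 ^ k M` with `d` a power of
`ϖ`, and `𝒜` is the ring of all `D`-linear endomorphisms of `V` that preserve the chain
(`IsLatticeModule.exists_eq_smul`).

*Same division algebra and index imply Morita equivalence* (`IsLatticeModule.moritaEquivalent`).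
The elements of `D` that preserve a lattice are those integral over `O`, whatever the order. As a
consequence, whether `d` in `D` maps `𝔓 ^ k M` into `𝔓 ^ l M` only depends on `D`, `e`, `k` and `l`.
The `D`-linear maps `V₂ → V₁` that map the `k`-th member of one chain into the `k`-th member of the
other one form a bimodule, and composition makes it and its counterpart in the opposite direction
into a Morita context. The algebras `D₁` and `D₂` of Brauer equivalent algebras are isomorphic
(`nonempty_algEquiv_end_of_isBrauerEquivalent`).

*Morita equivalence implies the rest.* Two bimodules with isomorphisms `I ⊗ J ≅ 𝒜₁` and
`J ⊗ I ≅ 𝒜₂` yield a Morita context (`exists_moritaContext`). The correspondence `𝔞 ↦ J 𝔞 I` of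
two-sided ideals is multiplicative and maps `ϖ 𝒜₁` to `ϖ 𝒜₂`; it maps the radical to the radical,
which is the largest two-sided ideal with a power in `ϖ 𝒜₁`. So the indices agree
(`MoritaContext.isIndex`). Writing `1` as a sum of values of the pairing `J × I → 𝒜₂` realizes `𝒜₂`
inside a matrix algebra over `A₁`; after extension of scalars to `K` the image of `A₂` is a corner
`ε C ε` of `C = Mₙ(A₁)`, and a corner of a simple Artinian algebra is Brauer equivalent to it
(`MoritaContext.isBrauerEquivalent`).
-/

namespace HereditaryOrders

/-! ### Irreducible polynomials over a henselian ring -/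

section Henselian

open Polynomial IsLocalRing

/-- If a finite group `G` acts on a domain `B` with fixed ring a henselian local ring `O`, then `G`
fixes every maximal ideal `P` of `B` above the maximal ideal of `O`. Otherwise some `α` fixed by
the stabilizer of `P` is `1` modulo `P` and `0` modulo the other conjugates of `P`; the polynomial
of the conjugates of `α` then has `1` as a simple root modulo the maximal ideal of `O`, so that
`α` lies in `O`, which is absurd. -/
theorem smul_mem_of_henselian {O B G : Type*} [CommRing O] [HenselianLocalRing O] [CommRing B]
    [IsDomain B] [Algebra O B] [Group G] [Finite G] [MulSemiringAction G B]
    [SMulCommClass G O B] [Algebra.IsInvariant O B G] (P : Ideal B) [P.IsMaximal]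
    (hP : ∀ a : O, algebraMap O B a ∈ P ↔ a ∈ maximalIdeal O)
    (τ : G) {x : B} (hx : x ∈ P) : τ • x ∈ P := by
  classical
  cases nonempty_fintype G
  let S : Finset G := Finset.univ.filter fun σ => ∀ y, y ∈ P ↔ σ • y ∈ P
  have hS : ∀ σ, σ ∈ S ↔ ∀ y, y ∈ P ↔ σ • y ∈ P := fun σ => by simp [S]
  have hS1 : (1 : G) ∈ S := by simp [hS]
  have hSinv : ∀ σ, σ ∈ S → σ⁻¹ ∈ S := fun σ h => by
    rw [hS] at h ⊢
    intro y
    rw [h (σ⁻¹ • y), smul_inv_smul]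
  have hSmul : ∀ σ ρ, σ ∈ S → ρ ∈ S → σ * ρ ∈ S := fun σ ρ h h' => by
    rw [hS] at *
    intro y
    rw [h', h, mul_smul]
  by_contra hcon
  have hτ : τ ∉ S := fun h => hcon (((hS τ).1 h x).1 hx)
  -- A maximal ideal contained in a conjugate of `P` equals it, as the conjugates are maximal.
  have hconj : ∀ σ, σ ∉ S → ∃ b, σ • b ∈ P ∧ b ∉ P := fun σ hσ => by
    by_contra! h
    let Q : Ideal B := P.comap (MulSemiringAction.toRingHom G B σ)
    have hQ : Q.IsPrime := Ideal.IsPrime.comap _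
    have hQP : Q ≤ P := fun b hb => h b hb
    have hQmax : Q.IsMaximal :=
      Ideal.comap_isMaximal_of_surjective _ fun y => ⟨σ⁻¹ • y, by simp⟩
    have := hQmax.eq_of_le (Ideal.IsMaximal.ne_top ‹_›) hQP
    exact hσ ((hS σ).2 fun y => (SetLike.ext_iff.1 this y).symm)
  choose! b hb hbP using hconj
  obtain ⟨β, hβ1, hβ⟩ : ∃ β : B, β - 1 ∈ P ∧ ∀ σ, σ ∉ S → σ • β ∈ P := by
    let β₀ := ∏ σ ∈ Finset.univ.filter (· ∉ S), b σ
    have hβ₀ : β₀ ∉ P := by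
      rw [Ideal.IsPrime.prod_mem_iff]
      rintro ⟨σ, hσ, h⟩
      exact hbP σ (by simpa using hσ) h
    obtain ⟨γ, hγ⟩ := Ideal.Quotient.exists_inv (I := P)
      (a := Ideal.Quotient.mk P β₀) (by rwa [Ne, Ideal.Quotient.eq_zero_iff_mem])
    obtain ⟨γ, rfl⟩ := Ideal.Quotient.mk_surjective γ
    refine ⟨β₀ * γ, ?_, fun σ hσ => ?_⟩
    · rw [← Ideal.Quotient.eq_zero_iff_mem, map_sub, map_mul, hγ, map_one, sub_self]
    · rw [smul_mul']
      refine P.mul_mem_right _ ?_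
      rw [Finset.smul_prod']
      exact P.prod_mem (i := σ) (by simpa using hσ) (hb σ hσ)
  let α := ∏ ρ ∈ S, ρ • β
  have hα1 : α - 1 ∈ P := by
    rw [← Ideal.Quotient.eq_zero_iff_mem, map_sub, map_prod, map_one, sub_eq_zero]
    refine Finset.prod_eq_one fun ρ hρ => ?_
    rw [← map_one (Ideal.Quotient.mk P), Ideal.Quotient.eq]
    have := ((hS ρ).1 hρ _).1 hβ1
    rwa [smul_sub, smul_one] at this
  have hαfix : ∀ σ ∈ S, σ • α = α := fun σ hσ => by
    simp only [α, Finset.smul_prod', ← mul_smul]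
    refine Finset.prod_bij (fun ρ _ => σ * ρ) (fun ρ hρ => hSmul _ _ hσ hρ) (by simp)
      (fun ρ hρ => ⟨σ⁻¹ * ρ, hSmul _ _ (hSinv _ hσ) hρ, by simp⟩) (by simp)
  have hα : ∀ σ, σ ∉ S → σ • α ∈ P := fun σ hσ => by
    simp only [α, Finset.smul_prod']
    exact P.prod_mem hS1 (by simpa using hβ σ hσ)
  -- The polynomial with roots the distinct conjugates of `α`.
  let T : Finset B := Finset.univ.image fun σ : G => σ • α
  have hαT : α ∈ T := Finset.mem_image.2 ⟨1, by simp⟩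
  let q : B[X] := ∏ y ∈ T, (X - C y)
  have hqinv : ∀ σ : G, σ • q = q := fun σ => by
    simp only [q, Finset.smul_prod', smul_sub, Polynomial.smul_X, Polynomial.smul_C]
    refine Finset.prod_bij (fun y _ => σ • y) ?_ (by simp) ?_ (by simp)
    · intro y hy
      obtain ⟨ρ, -, rfl⟩ := Finset.mem_image.1 hy
      exact Finset.mem_image.2 ⟨σ * ρ, by simp [mul_smul]⟩
    · intro y hy
      obtain ⟨ρ, -, rfl⟩ := Finset.mem_image.1 hy
      exact ⟨(σ⁻¹ * ρ) • α, Finset.mem_image.2 ⟨_, by simp, rfl⟩, by simp [mul_smul]⟩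
  have hqmonic : q.Monic := monic_prod_of_monic _ _ fun y _ => monic_X_sub_C y
  obtain ⟨c, hcq, -, hcm⟩ : ∃ c : O[X], c.map (algebraMap O B) = q ∧ c.degree = q.degree ∧
      c.Monic := by
    refine lifts_and_degree_eq_and_monic ?_ hqmonic
    rw [lifts_iff_coeff_lifts]
    intro n
    obtain ⟨a, ha⟩ := Algebra.IsInvariant.isInvariant (A := O) (G := G) (q.coeff n) fun σ => by
      rw [← coeff_smul, hqinv]
    exact ⟨a, ha⟩
  let q₁ : B[X] := ∏ y ∈ T.erase α, (X - C y)
  have hq : q = (X - C α) * q₁ := (Finset.mul_prod_erase T (fun y => X - C y) hαT).symm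
  have hcoe : ∀ p : O[X], algebraMap O B (p.eval 1) = (p.map (algebraMap O B)).eval 1 := fun p => by
    rw [eval_map, eval₂_at_one]
  have h1 : c.eval 1 ∈ maximalIdeal O := by
    rw [← hP, hcoe, hcq, hq]
    simp only [eval_mul, eval_sub, eval_X, eval_C]
    exact P.mul_mem_right _ (by rw [← neg_sub]; exact P.neg_mem hα1)
  have h2 : IsUnit (c.derivative.eval 1) := by
    rw [← notMem_maximalIdeal, ← hP, hcoe, ← derivative_map, hcq, hq]
    simp only [derivative_mul, derivative_sub, derivative_X, derivative_C, sub_zero, one_mul,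
      eval_add, eval_mul, eval_sub, eval_X, eval_C]
    intro h
    have h3 : q₁.eval 1 ∈ P := by
      refine (P.add_mem_iff_left (P.mul_mem_right _ ?_)).1 h
      rw [← neg_sub]; exact P.neg_mem hα1
    rw [eval_prod, Ideal.IsPrime.prod_mem_iff] at h3
    obtain ⟨y, hy, hyP⟩ := h3
    obtain ⟨hyα, hyT⟩ := Finset.mem_erase.1 hy
    obtain ⟨σ, -, rfl⟩ := Finset.mem_image.1 hyT
    have hσ : σ ∉ S := fun h => hyα (hαfix σ h)
    simp only [eval_sub, eval_X, eval_C] at hyP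
    exact (Ideal.ne_top_iff_one P).1 (Ideal.IsMaximal.ne_top ‹_›)
      (by simpa using P.add_mem hyP (hα σ hσ))
  obtain ⟨a, ha, ha1⟩ := HenselianLocalRing.is_henselian c hcm 1 h1 h2
  have hroot : q.eval (algebraMap O B a) = 0 := by
    rw [← hcq, eval_map, eval₂_at_apply, ha.eq_zero, map_zero]
  simp only [q, eval_prod, eval_sub, eval_X, eval_C, Finset.prod_eq_zero_iff, sub_eq_zero] at hroot
  obtain ⟨y, hyT, hy⟩ := hroot
  obtain ⟨σ, -, rfl⟩ := Finset.mem_image.1 hyT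
  have hαa : ∀ ρ : G, ρ • α = algebraMap O B a := fun ρ => by
    rw [← smul_algebraMap (ρ * σ⁻¹) a, hy, ← mul_smul, inv_mul_cancel_right]
  have haP : a ∈ maximalIdeal O := (hP a).1 (by rw [← hαa τ]; exact hα τ hτ)
  exact (Ideal.ne_top_iff_one _).1 (maximalIdeal.isMaximal O).ne_top
    (by simpa using sub_mem haP ha1)

/-- Over an integrally closed henselian local ring, the reduction of an irreducible monic polynomial
does not have both `0` and `1` as a root, separable case: in the integral closure of `O` in a
splitting field, `0` and `1` would be congruent modulo a maximal ideal to conjugates of a root `y`,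
and conjugation preserves this ideal. -/
theorem isUnit_eval_of_separable {O : Type*} [CommRing O] [IsDomain O] [IsIntegrallyClosed O]
    [HenselianLocalRing O] {h : O[X]} (hm : h.Monic) (hirr : Irreducible h)
    (hsep : (h.map (algebraMap O (FractionRing O))).Separable) :
    IsUnit (h.eval 0) ∨ IsUnit (h.eval 1) := by
  by_contra! hcon
  obtain ⟨h0, h1⟩ := hcon
  let K := FractionRing O
  let L := (h.map (algebraMap O K)).SplittingField
  have : IsGalois K L := IsGalois.of_separable_splitting_field hsep
  let B := integralClosure O L
  have : IsIntegralClosure B O L := inferInstance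
  have : IsFractionRing B L := integralClosure.isFractionRing_of_finite_extension K L
  have : Algebra.IsInvariant O B (B ≃ₐ[O] B) := Algebra.isInvariant_of_isGalois' O K L B
  have : Finite (B ≃ₐ[O] B) := Finite.of_equiv _ (galRestrict O K L B).toEquiv
  cases nonempty_fintype (B ≃ₐ[O] B)
  have : FaithfulSMul O L := FaithfulSMul.trans O K L
  have hinj : Function.Injective (algebraMap O B) := fun a b hab =>
    FaithfulSMul.algebraMap_injective O L (congrArg Subtype.val hab)
  have : Module.IsTorsionFree O B := Module.isTorsionFree_iff_algebraMap_injective.2 hinj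
  obtain ⟨P, hPmax, hPc⟩ := Ideal.exists_ideal_over_maximal_of_isIntegral (S := B)
    (maximalIdeal O) (by rw [(RingHom.injective_iff_ker_eq_bot _).1 hinj]; exact bot_le)
  have hP : ∀ a : O, algebraMap O B a ∈ P ↔ a ∈ maximalIdeal O := fun a => by
    rw [← hPc, Ideal.mem_comap]
  obtain ⟨y, hy⟩ : ∃ y : B, aeval y h = 0 := by
    have hd : ((h.map (algebraMap O K)).map (algebraMap K L)).degree ≠ 0 := by
      rw [degree_map, hm.degree_map]
      exact fun h' => hirr.not_isUnit (by
        rw [hm.natDegree_eq_zero.1 (natDegree_eq_of_degree_eq_some h')]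
        exact isUnit_one)
    obtain ⟨z, hz⟩ := (SplittingField.splits (h.map (algebraMap O K))).exists_eval_eq_zero hd
    rw [Polynomial.map_map, ← IsScalarTower.algebraMap_eq, eval_map_algebraMap] at hz
    have hzB : z ∈ B := ⟨h, hm, by rwa [← aeval_def]⟩
    refine ⟨⟨z, hzB⟩, Subtype.ext ?_⟩
    have hval := aeval_algHom_apply B.val (⟨z, hzB⟩ : B) h
    exact hval.symm.trans hz
  have hint : IsIntegral O y := ⟨h, hm, by rwa [← aeval_def]⟩
  have hmin : minpoly O y = h := by
    have := minpoly.isIntegrallyClosed_dvd hint hy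
    exact eq_of_monic_of_associated (minpoly.monic hint) hm
      ((minpoly.irreducible hint).associated_of_dvd hirr this)
  -- `h` divides the polynomial `c` of all conjugates of `y`.
  obtain ⟨c, hc⟩ : ∃ c : O[X],
      c.map (algebraMap O B) = ∏ σ : B ≃ₐ[O] B, (X - C (σ • y)) := by
    rw [← mem_lifts, lifts_iff_coeff_lifts]
    intro n
    obtain ⟨a, ha⟩ := Algebra.IsInvariant.isInvariant (A := O) (G := B ≃ₐ[O] B)
      ((∏ σ : B ≃ₐ[O] B, (X - C (σ • y))).coeff n) fun σ => by
        rw [← coeff_smul, Finset.smul_prod']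
        congr 1
        simp only [smul_sub, Polynomial.smul_X, Polynomial.smul_C, ← mul_smul]
        exact Fintype.prod_bijective (fun ρ => σ * ρ) (Group.mulLeft_bijective σ) _ _ (by simp)
    exact ⟨a, ha⟩
  have hcy : aeval y c = 0 := by
    rw [← eval_map_algebraMap, hc, eval_prod]
    exact Finset.prod_eq_zero (Finset.mem_univ 1) (by simp)
  have hdvd : h ∣ c := hmin ▸ minpoly.isIntegrallyClosed_dvd hint hcy
  have key : ∀ t : O, ¬ IsUnit (h.eval t) → ∃ σ : B ≃ₐ[O] B, algebraMap O B t - σ • y ∈ P := by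
    intro t ht
    have : algebraMap O B (c.eval t) ∈ P := by
      rw [hP]
      exact Ideal.mem_of_dvd _ (eval_dvd hdvd) ((mem_maximalIdeal _).2 ht)
    rw [← eval₂_at_apply, ← eval_map, hc, eval_prod, Ideal.IsPrime.prod_mem_iff] at this
    simpa using this
  obtain ⟨σ, hσ⟩ := key 0 h0
  obtain ⟨ρ, hρ⟩ := key 1 h1
  have h2 := smul_mem_of_henselian P hP (ρ * σ⁻¹) hσ
  rw [map_zero, zero_sub, smul_neg, ← mul_smul, inv_mul_cancel_right] at h2
  rw [map_one] at hρ
  exact (Ideal.ne_top_iff_one P).1 hPmax.ne_top (by simpa using P.sub_mem hρ h2)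

/-- Over an integrally closed henselian local ring, the reduction of an irreducible monic polynomial
does not have both `0` and `1` as a root. The polynomial is `h (X ^ q)` for some separable `h` and a
power `q` of the characteristic exponent, and it takes the same values at `0` and `1` as `h`. -/
theorem isUnit_eval_of_irreducible {O : Type*} [CommRing O] [IsDomain O] [IsIntegrallyClosed O]
    [HenselianLocalRing O] {g : O[X]} (hm : g.Monic) (hirr : Irreducible g) :
    IsUnit (g.eval 0) ∨ IsUnit (g.eval 1) := by
  let K := FractionRing O
  have hinj : Function.Injective (algebraMap O K) := FaithfulSMul.algebraMap_injective O K
  have hK := (hm.irreducible_iff_irreducible_map_fraction_map (K := K)).1 hirr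
  let p := ringExpChar K
  obtain ⟨f, hf, m, hfm⟩ := hK.hasSeparableContraction p
  have hp : p ^ m ≠ 0 := pow_ne_zero _ (expChar_pos K p).ne'
  let h := g.contract (p ^ m)
  have hh : h.map (algebraMap O K) = f := by rw [map_contract hp, ← hfm, contract_expand _ hp]
  have hg : expand O (p ^ m) h = g := by
    apply map_injective _ hinj
    rw [map_expand, hh, hfm]
  have hhm : h.Monic := by
    rw [← monic_expand_iff (Nat.pos_of_ne_zero hp), hg]
    exact hm
  rw [← hg] at hirr
  have := isUnit_eval_of_separable hhm (of_irreducible_expand hp hirr) (hh ▸ hf)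
  rwa [← hg, expand_eval, expand_eval, zero_pow hp, one_pow]

end Henselian

/-! ### Lattices in a simple module form a chain -/

section Lattices

open Polynomial IsLocalRing
open scoped Pointwise

theorem isNoetherianRing_of_finite_algebra (O R : Type*) [CommRing O] [IsNoetherianRing O] [Ring R]
    [Algebra O R] [Module.Finite O R] : IsNoetherianRing R :=
  isNoetherian_of_tower O (inferInstance : IsNoetherian O R)

/-- The situation in which lattices are studied. `R` is to be thought of as a hereditary `O`-order
in a central simple algebra `A` over the fraction field of `O`, `V` as the simple `A`-module and `D`
as its endomorphism ring. The lattices are the nonzero finitely generated `R`-submodules of `V`;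
neither `A` nor the fraction field of `O` (whose elements act through `D`) is mentioned. -/
structure IsLatticeModule (O R D V : Type*) [CommRing O] [Ring R] [DivisionRing D] [AddCommGroup V]
    [Module O V] [Module R V] [Module D V] : Prop where
  /-- Lattices are projective, as `R` is hereditary. -/
  projective : ∀ L : Submodule R V, L.FG → Module.Projective R L
  /-- `V` becomes simple after inverting the nonzero elements of `O`. -/
  exists_smul_eq : ∀ x : V, x ≠ 0 → ∀ v : V, ∃ c : O, c ≠ 0 ∧ ∃ r : R, c • v = r • x
  /-- Homomorphisms from a lattice to `V` are given by elements of `D`. -/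
  exists_hom : ∀ (L : Submodule R V) (f : L →ₗ[R] V), ∃ d : D, ∀ x : L, f x = d • (x : V)
  /-- `R` embeds into a power of `V`. -/
  exists_embedding : ∃ (n : ℕ) (j : R →ₗ[R] (Fin n → V)), Function.Injective j

variable {O R D V : Type*} [CommRing O] [Ring R] [Algebra O R] [DivisionRing D] [Algebra O D]
  [AddCommGroup V] [Module O V] [Module R V] [Module D V] [IsScalarTower O R V]
  [IsScalarTower O D V]

theorem aeval_smul_mem {S : Submodule R V} {d : D} (hd : ∀ x ∈ S, d • x ∈ S) (p : O[X]) {x : V}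
    (hx : x ∈ S) : aeval d p • x ∈ S := by
  induction p using Polynomial.induction_on generalizing x with
  | C a =>
    rw [aeval_C, algebraMap_smul, ← algebraMap_smul R]
    exact S.smul_mem _ hx
  | add p q hp hq =>
    rw [map_add, add_smul]
    exact S.add_mem (hp hx) (hq hx)
  | monomial n a h =>
    rw [pow_succ, ← mul_assoc, map_mul, aeval_X, mul_smul]
    exact h (hd x hx)

/-- An element of `D` that preserves a lattice is integral, by the Cayley-Hamilton theorem. -/
theorem isIntegral_of_smul_mem [Module.Finite O R] {S : Submodule R V} (hS : S.FG) (hne : S ≠ ⊥)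
    {d : D} (hd : ∀ x ∈ S, d • x ∈ S) : IsIntegral O d := by
  have : Module.Finite R S := Module.Finite.of_fg hS
  have : Module.Finite O S := Module.Finite.trans R S
  let f : Module.End O S :=
    { toFun := fun x => ⟨d • (x : V), hd x x.2⟩
      map_add' := fun x y => Subtype.ext (smul_add _ _ _)
      map_smul' := fun c x => Subtype.ext (smul_comm d c (x : V)) }
  obtain ⟨p, hp, hp0⟩ := LinearMap.exists_monic_and_aeval_eq_zero O f
  have key : ∀ (p : O[X]) (x : S), ((aeval f p x : S) : V) = aeval d p • (x : V) := by
    intro p x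
    induction p using Polynomial.induction_on generalizing x with
    | C a => simp
    | add p q hp hq => simp [hp, hq, add_smul]
    | monomial n a h =>
      rw [pow_succ, ← mul_assoc, map_mul (aeval f), map_mul (aeval d), aeval_X, aeval_X, mul_smul,
        Module.End.mul_apply, h]
      rfl
  obtain ⟨x, hx, hx0⟩ := S.exists_mem_ne_zero_of_ne_bot hne
  refine ⟨p, hp, ?_⟩
  rw [← aeval_def]
  have := key p ⟨x, hx⟩
  rw [hp0] at this
  exact (smul_eq_zero.1 this.symm).resolve_right hx0

/-- An endomorphism of a lattice is surjective or differs from the identity by a surjective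
endomorphism: if the minimal polynomial of `d` has a unit as its value at `t`, then `d - t` has an
inverse in `O[d]`, and `t = 0` or `t = 1` will do. -/
theorem exists_smul_eq_or [IsDomain O] [IsIntegrallyClosed O] [HenselianLocalRing O]
    [Module.Finite O R] {S : Submodule R V} (hS : S.FG) (hne : S ≠ ⊥)
    {d : D} (hd : ∀ x ∈ S, d • x ∈ S) :
    (∀ x ∈ S, ∃ y ∈ S, x = d • y) ∨ (∀ x ∈ S, ∃ y ∈ S, x = (d - 1) • y) := by
  have hint := isIntegral_of_smul_mem (O := O) hS hne hd
  have key : ∀ t : O, IsUnit ((minpoly O d).eval t) →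
      ∀ x ∈ S, ∃ y ∈ S, x = (d - algebraMap O D t) • y := by
    rintro t ⟨u, hu⟩ x hx
    obtain ⟨q, hq⟩ := X_sub_C_dvd_sub_C_eval (a := t) (p := minpoly O d)
    have hq' := congrArg (aeval d) hq
    rw [map_sub, minpoly.aeval, map_mul, map_sub, aeval_X, aeval_C, aeval_C, zero_sub, ← hu] at hq'
    refine ⟨aeval d (C (-((u⁻¹ : Oˣ) : O)) * q) • x, aeval_smul_mem hd _ hx, ?_⟩
    rw [← mul_smul, mul_comm (C _), map_mul, ← mul_assoc, ← hq', aeval_C, neg_mul, ← map_mul,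
      mul_neg, Units.mul_inv, map_neg, map_one, neg_neg, one_smul]
  refine (isUnit_eval_of_irreducible (minpoly.monic hint) (minpoly.irreducible hint)).imp
    (fun h => ?_) (fun h => ?_)
  · simpa using key 0 h
  · simpa using key 1 h

namespace IsLatticeModule

/-- The lattices form a chain: their sum is projective, so that it is a direct summand of their
direct sum. The corresponding idempotent maps the sum into `M`, and its complement maps the sum into
`N`; one of the two is surjective. -/
theorem le_total [IsDomain O] [IsIntegrallyClosed O] [HenselianLocalRing O] [Module.Finite O R]
    (h : IsLatticeModule O R D V) {M N : Submodule R V} (hM : M.FG) (hN : N.FG) :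
    M ≤ N ∨ N ≤ M := by
  by_cases hne : M ⊔ N = ⊥
  · exact Or.inl (by rw [(sup_eq_bot_iff.1 hne).1]; exact bot_le)
  have hS : (M ⊔ N).FG := hM.sup hN
  have := h.projective _ hS
  let π : M × N →ₗ[R] (M ⊔ N : Submodule R V) :=
    (Submodule.inclusion le_sup_left).coprod (Submodule.inclusion le_sup_right)
  have hπ : Function.Surjective π := by
    rintro ⟨x, hx⟩
    obtain ⟨y, hy, z, hz, rfl⟩ := Submodule.mem_sup.1 hx
    exact ⟨(⟨y, hy⟩, ⟨z, hz⟩), Subtype.ext rfl⟩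
  obtain ⟨s, hs⟩ := Module.projective_lifting_property π LinearMap.id hπ
  obtain ⟨d, hd⟩ := h.exists_hom _ (M.subtype ∘ₗ LinearMap.fst R M N ∘ₗ s)
  have hdM : ∀ x ∈ M ⊔ N, d • x ∈ M := fun x hx => by
    rw [← hd ⟨x, hx⟩]; exact (s ⟨x, hx⟩).1.2
  have hdN : ∀ x ∈ M ⊔ N, (d - 1) • x ∈ N := fun x hx => by
    have h1 : x = ((s ⟨x, hx⟩).1 : V) + ((s ⟨x, hx⟩).2 : V) :=
      (congrArg Subtype.val (LinearMap.congr_fun hs ⟨x, hx⟩)).symm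
    have h2 : ((s ⟨x, hx⟩).1 : V) = d • x := hd ⟨x, hx⟩
    rw [h2] at h1
    have h3 : (d - 1) • x = -((s ⟨x, hx⟩).2 : V) := by
      rw [sub_smul, one_smul, sub_eq_iff_eq_add, neg_add_eq_sub, eq_sub_iff_add_eq]
      exact h1.symm
    rw [h3]
    exact N.neg_mem (s ⟨x, hx⟩).2.2
  rcases exists_smul_eq_or (O := O) hS hne fun x hx => le_sup_left (a := M) (hdM x hx) with
    h1 | h1
  · refine Or.inr fun x hx => ?_
    obtain ⟨y, hy, rfl⟩ := h1 x (le_sup_right (a := M) hx)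
    exact hdM y hy
  · refine Or.inl fun x hx => ?_
    obtain ⟨y, hy, rfl⟩ := h1 x (le_sup_left (a := M) hx)
    exact hdN y hy

end IsLatticeModule

theorem jacobson_le_smul_top_of_projective (R P : Type*) [Ring R] [AddCommGroup P] [Module R P]
    [Module.Projective R P] : Module.jacobson R P ≤ Ring.jacobson R • (⊤ : Submodule R P) := by
  intro x hx
  obtain ⟨s, hs⟩ := Module.projective_def'.1 (inferInstance : Module.Projective R P)
  rw [← LinearMap.id_apply (R := R) x, ← hs, LinearMap.comp_apply,
    Finsupp.linearCombination_apply]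
  refine Submodule.sum_mem _ fun i _ => Submodule.smul_mem_smul ?_ trivial
  exact Module.le_comap_jacobson (Finsupp.lapply i ∘ₗ s) hx

variable [IsDomain O] [IsDiscreteValuationRing O] [Module.Finite O R]

namespace IsLatticeModule

/-- The lattice `𝔓 • M`, where `𝔓` is the radical of `R`, contains all lattices strictly
contained in `M`: as lattices form a chain, a proper sublattice lies in each maximal submodule of
`M`. -/
theorem le_jacobson_smul_of_lt [HenselianLocalRing O]
    (h : IsLatticeModule O R D V) {M N : Submodule R V} (hM : M.FG) (hN : N < M) :
    N ≤ Ring.jacobson R • M := by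
  have := isNoetherianRing_of_finite_algebra O R
  have := h.projective M hM
  have hMn : IsNoetherian R M := isNoetherian_of_fg_of_noetherian M hM
  have hfg : ∀ L : Submodule R V, L ≤ M → L.FG := fun L hL => by
    have := (IsNoetherian.noetherian (L.comap M.subtype)).map M.subtype
    rwa [Submodule.map_comap_subtype, inf_eq_right.2 hL] at this
  have hjac : N.comap M.subtype ≤ Module.jacobson R M := by
    refine le_sInf fun m hm => ?_
    rcases h.le_total (hfg N hN.le) (hfg _ (Submodule.map_subtype_le M m)) with h1 | h1
    · rw [← Submodule.comap_map_eq_of_injective M.injective_subtype m]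
      exact Submodule.comap_mono h1
    · have h2 : m ≤ N.comap M.subtype := Submodule.map_le_iff_le_comap.1 h1
      refine ((hm.le_iff.1 h2).resolve_left fun h3 => ?_).le
      exact hN.not_ge ((Submodule.comap_subtype_eq_top).1 h3)
  have := Submodule.map_mono (f := M.subtype)
    (hjac.trans (jacobson_le_smul_top_of_projective R M))
  rwa [Submodule.map_smul'', Submodule.map_comap_subtype, inf_eq_right.2 hN.le,
    Submodule.map_subtype_top] at this

end IsLatticeModule

end Lattices

/-! ### The radical series of a lattice -/

section RadicalSeries

open Polynomial IsLocalRing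
open scoped Pointwise

variable {O R D V : Type*} [CommRing O] [Ring R] [Algebra O R] [DivisionRing D] [Algebra O D]
  [AddCommGroup V] [Module O V] [Module R V] [Module D V] [IsScalarTower O R V]
  [IsScalarTower O D V] [SMulCommClass D R V]

theorem smul_ideal_smul {R D V : Type*} [Ring R] [DivisionRing D] [AddCommGroup V] [Module R V]
    [Module D V] [SMulCommClass D R V] (d : D) (I : Ideal R) (M : Submodule R V) :
    d • (I • M) = I • (d • M) :=
  Submodule.map_smul'' I M _

theorem pow_smul_le_pow_smul {R V : Type*} [Ring R] [AddCommGroup V] [Module R V] (I : Ideal R)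
    (M : Submodule R V) {m n : ℕ} (h : m ≤ n) : I ^ n • M ≤ I ^ m • M := by
  induction n, h using Nat.le_induction with
  | base => exact le_rfl
  | succ n _ ih =>
    refine le_trans ?_ ih
    rw [Submodule.pow_succ, Submodule.mul_smul]
    exact Submodule.smul_mono le_rfl Submodule.smul_le_right

theorem pow_add_smul {R V : Type*} [Ring R] [AddCommGroup V] [Module R V] (I : Ideal R)
    (M : Submodule R V) (m n : ℕ) : I ^ (m + n) • M = I ^ m • I ^ n • M := by
  rcases eq_or_ne n 0 with rfl | hn
  · rw [add_zero, Submodule.pow_zero, Ideal.one_eq_top, Submodule.top_smul]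
  · rw [Submodule.pow_add _ hn, Submodule.mul_smul]

variable [IsDomain O] [IsDiscreteValuationRing O]

theorem IsLatticeModule.exists_pow_smul_le (h : IsLatticeModule O R D V) {ϖ : O}
    (hϖ : Irreducible ϖ) {M N : Submodule R V} (hne : M ≠ ⊥) (hN : N.FG) :
    ∃ q : ℕ, algebraMap O D ϖ ^ q • N ≤ M := by
  obtain ⟨x, hx, hx0⟩ := M.exists_mem_ne_zero_of_ne_bot hne
  have hsc : ∀ (v : V) (q : ℕ), algebraMap O D ϖ ^ q • v = ϖ ^ q • v := fun v q => by
    rw [← map_pow, algebraMap_smul]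
  have hmem : ∀ v : V, ∃ q : ℕ, ϖ ^ q • v ∈ M := fun v => by
    obtain ⟨c, hc, r, hr⟩ := h.exists_smul_eq x hx0 v
    obtain ⟨q, u, hu⟩ := IsDiscreteValuationRing.eq_unit_mul_pow_irreducible hc hϖ
    refine ⟨q, ?_⟩
    have h1 : ϖ ^ q • v = (algebraMap O R (↑u⁻¹ : O) * r) • x := by
      rw [mul_smul, ← hr, algebraMap_smul, ← mul_smul, hu, ← mul_assoc, Units.inv_mul, one_mul]
    rw [h1]
    exact M.smul_mem _ hx
  obtain ⟨s, rfl⟩ := hN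
  choose q hq using hmem
  refine ⟨s.sup q, ?_⟩
  rintro _ ⟨v, hv, rfl⟩
  change algebraMap O D ϖ ^ _ • v ∈ M
  rw [hsc]
  induction hv using Submodule.span_induction with
  | mem v hv =>
    obtain ⟨k, hk⟩ := Nat.exists_eq_add_of_le (Finset.le_sup (f := q) hv)
    rw [hk, add_comm, pow_add, mul_smul, ← algebraMap_smul R (ϖ ^ k)]
    exact M.smul_mem _ (hq v)
  | zero => simp
  | add v w _ _ hv hw => rw [smul_add]; exact M.add_mem hv hw
  | smul r v _ hv => rw [smul_comm]; exact M.smul_mem _ hv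

variable [Module.Finite O R]

theorem algebraMap_smul_lt {ϖ : O} (hϖ : Irreducible ϖ) {M : Submodule R V} (hM : M.FG)
    (hne : M ≠ ⊥) : algebraMap O D ϖ • M < M := by
  have hle : algebraMap O D ϖ • M ≤ M := by
    rintro _ ⟨x, hx, rfl⟩
    change algebraMap O D ϖ • x ∈ M
    rw [algebraMap_smul, ← algebraMap_smul R]
    exact M.smul_mem _ hx
  refine lt_of_le_of_ne hle fun heq => hne ?_
  have : Module.Finite R M := Module.Finite.of_fg hM
  have : Module.Finite O M := Module.Finite.trans R M
  have hfg : (M.restrictScalars O).FG := Module.Finite.iff_fg.1 this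
  have := hfg.eq_bot_of_le_jacobson_smul fun x hx => by
    rw [Submodule.restrictScalars_mem, ← heq] at hx
    obtain ⟨y, hy, rfl⟩ := hx
    change algebraMap O D ϖ • y ∈ _
    rw [algebraMap_smul]
    refine Submodule.smul_mem_smul ?_ hy
    rw [IsLocalRing.ringJacobson_eq_maximalIdeal]
    exact (mem_maximalIdeal _).2 hϖ.not_isUnit
  rwa [Submodule.restrictScalars_eq_bot_iff] at this

theorem fg_smul {M : Submodule R V} (hM : M.FG) (d : D) : (d • M).FG := hM.map _

theorem smul_ne_bot {M : Submodule R V} (hne : M ≠ ⊥) {d : D} (hd : d ≠ 0) : d • M ≠ ⊥ := by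
  intro h
  obtain ⟨x, hx, hx0⟩ := M.exists_mem_ne_zero_of_ne_bot hne
  have := Submodule.smul_mem_pointwise_smul x d M hx
  rw [h, Submodule.mem_bot, smul_eq_zero] at this
  exact this.elim hd hx0

theorem smul_le_smul_iff_of_ne_zero {M N : Submodule R V} {d : D} (hd : d ≠ 0) :
    d • M ≤ d • N ↔ M ≤ N :=
  Submodule.map_le_map_iff_of_injective (smul_right_injective V hd) M N

theorem smul_inj_of_ne_zero {M N : Submodule R V} {d : D} (hd : d ≠ 0) : d • M = d • N ↔ M = N :=
  (Submodule.map_injective_of_injective (smul_right_injective V hd)).eq_iff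

theorem fg_ideal_smul [IsNoetherianRing R] (I : Ideal R) {M : Submodule R V} (hM : M.FG) :
    (I • M).FG := by
  have := isNoetherian_of_fg_of_noetherian M hM
  have := (IsNoetherian.noetherian ((I • M).comap M.subtype)).map M.subtype
  rwa [Submodule.map_comap_subtype, inf_eq_right.2 Submodule.smul_le_right] at this

theorem algebraMap_ne_zero_of_irreducible {O D : Type*} [CommRing O] [DivisionRing D] [Algebra O D]
    [FaithfulSMul O D] {ϖ : O} (hϖ : Irreducible ϖ) : algebraMap O D ϖ ≠ 0 :=
  (map_ne_zero_iff _ (FaithfulSMul.algebraMap_injective O D)).2 hϖ.ne_zero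

variable [HenselianLocalRing O]

namespace IsLatticeModule

theorem algebraMap_smul_le_jacobson_smul (h : IsLatticeModule O R D V) {ϖ : O} (hϖ : Irreducible ϖ)
    {M : Submodule R V} (hM : M.FG) : algebraMap O D ϖ • M ≤ Ring.jacobson R • M := by
  by_cases hne : M = ⊥
  · simp [hne]
  · exact h.le_jacobson_smul_of_lt hM (algebraMap_smul_lt hϖ hM hne)

/-- A lattice between `M` and some `𝔓 ^ k • M` is a power of the radical `𝔓` times `M`. -/
theorem exists_eq_jacobson_pow_smul {O R D V : Type*} [CommRing O] [IsDomain O]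
    [IsDiscreteValuationRing O] [HenselianLocalRing O] [Ring R] [Algebra O R] [Module.Finite O R]
    [DivisionRing D] [Algebra O D] [AddCommGroup V] [Module O V] [Module R V] [Module D V]
    [IsScalarTower O R V] [IsScalarTower O D V] (h : IsLatticeModule O R D V) {M N : Submodule R V}
    (hM : M.FG) (hNM : N ≤ M) (hk : ∃ k, ¬ N ≤ Ring.jacobson R ^ k • M) :
    ∃ n, N = Ring.jacobson R ^ n • M := by
  have := isNoetherianRing_of_finite_algebra O R
  classical
  have h0 : Nat.find hk ≠ 0 := fun h0 => by
    have := Nat.find_spec hk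
    rw [h0, Submodule.pow_zero, Ideal.one_eq_top, Submodule.top_smul] at this
    exact this hNM
  obtain ⟨n, hn⟩ := Nat.exists_eq_succ_of_ne_zero h0
  have h1 : N ≤ Ring.jacobson R ^ n • M := not_not.1 (Nat.find_min hk (hn ▸ n.lt_succ_self))
  have h2 := Nat.find_spec hk
  refine ⟨n, h1.eq_of_not_lt fun h3 => h2 ?_⟩
  rw [hn, Nat.succ_eq_add_one, add_comm, pow_add_smul, Submodule.pow_one]
  exact h.le_jacobson_smul_of_lt (fg_ideal_smul _ hM) h3

variable [FaithfulSMul O D]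

theorem jacobson_smul_ne_bot (h : IsLatticeModule O R D V) {ϖ : O} (hϖ : Irreducible ϖ)
    {M : Submodule R V} (hM : M.FG) (hne : M ≠ ⊥) : Ring.jacobson R • M ≠ ⊥ := fun h0 =>
  smul_ne_bot hne (algebraMap_ne_zero_of_irreducible (D := D) hϖ)
    (le_bot_iff.1 (h0 ▸ h.algebraMap_smul_le_jacobson_smul hϖ hM))

theorem jacobson_pow_smul_ne_bot (h : IsLatticeModule O R D V) {ϖ : O} (hϖ : Irreducible ϖ)
    {M : Submodule R V} (hM : M.FG) (hne : M ≠ ⊥) (k : ℕ) : Ring.jacobson R ^ k • M ≠ ⊥ := by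
  have := isNoetherianRing_of_finite_algebra O R
  induction k generalizing M with
  | zero => rwa [Submodule.pow_zero, Ideal.one_eq_top, Submodule.top_smul]
  | succ k ih =>
    rw [Submodule.pow_succ, Submodule.mul_smul]
    exact ih (fg_ideal_smul _ hM) (h.jacobson_smul_ne_bot hϖ hM hne)

theorem jacobson_pow_succ_smul_lt (h : IsLatticeModule O R D V) {ϖ : O} (hϖ : Irreducible ϖ)
    {M : Submodule R V} (hM : M.FG) (hne : M ≠ ⊥) (k : ℕ) :
    Ring.jacobson R ^ (k + 1) • M < Ring.jacobson R ^ k • M := by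
  have := isNoetherianRing_of_finite_algebra O R
  rw [add_comm, pow_add_smul, Submodule.pow_one]
  exact Submodule.FG.jacobson_smul_lt (h.jacobson_pow_smul_ne_bot hϖ hM hne k)
    (fg_ideal_smul _ hM)

theorem jacobson_pow_smul_le_iff (h : IsLatticeModule O R D V) {ϖ : O} (hϖ : Irreducible ϖ)
    {M : Submodule R V} (hM : M.FG) (hne : M ≠ ⊥) {m n : ℕ} :
    Ring.jacobson R ^ m • M ≤ Ring.jacobson R ^ n • M ↔ n ≤ m :=
  (strictAnti_nat_of_succ_lt (f := fun k => Ring.jacobson R ^ k • M)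
    (h.jacobson_pow_succ_smul_lt hϖ hM hne)).le_iff_ge

/-- The quotient `M / ϖ M` has finite length, so that the radical series of `M` drops below
`ϖ M`. -/
theorem exists_not_algebraMap_smul_le (h : IsLatticeModule O R D V) {ϖ : O} (hϖ : Irreducible ϖ)
    {M : Submodule R V} (hM : M.FG) (hne : M ≠ ⊥) :
    ∃ k, ¬ algebraMap O D ϖ • M ≤ Ring.jacobson R ^ k • M := by
  by_contra! hcon
  have : Module.Finite R M := Module.Finite.of_fg hM
  have : Module.Finite O M := Module.Finite.trans R M
  let Q := M ⧸ (maximalIdeal O • ⊤ : Submodule O M)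
  let _ : Field (O ⧸ maximalIdeal O) := Ideal.Quotient.field _
  have : Module.Finite (O ⧸ maximalIdeal O) Q := Module.Finite.of_restrictScalars_finite O _ _
  have : IsArtinian (O ⧸ maximalIdeal O) Q := inferInstance
  have : IsArtinian O Q :=
    isArtinian_of_surjective_algebraMap (R := O ⧸ maximalIdeal O) Ideal.Quotient.mk_surjective
  let π : M →ₗ[O] Q := Submodule.mkQ _
  have hanti : Antitone fun k => ((Ring.jacobson R ^ k • M).comap M.subtype).restrictScalars O :=
    fun m n hmn x hx => pow_smul_le_pow_smul _ M hmn hx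
  obtain ⟨n, hn⟩ := IsArtinian.monotone_stabilizes (R := O) (M := Q)
    ⟨fun k => OrderDual.toDual
      ((((Ring.jacobson R ^ k • M).comap M.subtype).restrictScalars O).map π),
      fun m n hmn => Submodule.map_mono (hanti hmn)⟩
  refine (h.jacobson_pow_succ_smul_lt hϖ hM hne n).not_ge fun x hx => ?_
  have hxM : x ∈ M := Submodule.smul_le_right hx
  have h1 : π ⟨x, hxM⟩ ∈
      (((Ring.jacobson R ^ (n + 1) • M).comap M.subtype).restrictScalars O).map π := by
    have := hn (n + 1) n.le_succ
    change Submodule.map π _ = Submodule.map π _ at this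
    rw [← this]
    exact Submodule.mem_map_of_mem hx
  obtain ⟨y, hy, hyx⟩ := h1
  have h2 : y - ⟨x, hxM⟩ ∈ (maximalIdeal O • ⊤ : Submodule O M) := (Submodule.Quotient.eq _).1 hyx
  rw [hϖ.maximalIdeal_eq, Submodule.ideal_span_singleton_smul] at h2
  obtain ⟨z, -, hz⟩ := h2
  have h3 : (y : V) - x ∈ Ring.jacobson R ^ (n + 1) • M := by
    refine hcon (n + 1) ?_
    have : (y : V) - x = ϖ • (z : V) := (congrArg Subtype.val hz).symm
    rw [this, ← algebraMap_smul D]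
    exact Submodule.smul_mem_pointwise_smul _ _ _ z.2
  simpa using (Ring.jacobson R ^ (n + 1) • M).sub_mem hy h3

theorem exists_jacobson_pow_smul_eq (h : IsLatticeModule O R D V) {ϖ : O} (hϖ : Irreducible ϖ)
    {M : Submodule R V} (hM : M.FG) (hne : M ≠ ⊥) :
    ∃ e, 0 < e ∧ Ring.jacobson R ^ e • M = algebraMap O D ϖ • M := by
  have hlt := algebraMap_smul_lt (D := D) hϖ hM hne
  obtain ⟨e, he⟩ := h.exists_eq_jacobson_pow_smul hM hlt.le
    (h.exists_not_algebraMap_smul_le hϖ hM hne)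
  refine ⟨e, Nat.pos_of_ne_zero ?_, he.symm⟩
  rintro rfl
  rw [Submodule.pow_zero, Ideal.one_eq_top, Submodule.top_smul] at he
  exact hlt.ne he

/-- Any two lattices `M` and `N` are related by powers of `ϖ` and of the radical. -/
theorem exists_pow_smul_eq (h : IsLatticeModule O R D V) {ϖ : O} (hϖ : Irreducible ϖ)
    {M N : Submodule R V} (hM : M.FG) (hMne : M ≠ ⊥) (hN : N.FG) (hNne : N ≠ ⊥) :
    ∃ q n : ℕ, algebraMap O D ϖ ^ q • N = Ring.jacobson R ^ n • M := by
  have hϖ0 := algebraMap_ne_zero_of_irreducible (D := D) hϖ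
  obtain ⟨q, hq⟩ := h.exists_pow_smul_le hϖ hMne hN
  have hN' : algebraMap O D ϖ ^ q • N ≠ ⊥ := smul_ne_bot hNne (pow_ne_zero _ hϖ0)
  obtain ⟨t, ht⟩ := h.exists_pow_smul_le hϖ hN' hM
  obtain ⟨e, -, he⟩ := h.exists_jacobson_pow_smul_eq hϖ hM hMne
  have hpow : ∀ t : ℕ, Ring.jacobson R ^ (e * t) • M = algebraMap O D ϖ ^ t • M := fun t => by
    induction t with
    | zero => simp [Submodule.pow_zero, Ideal.one_eq_top]
    | succ t ih =>
      rw [mul_add, mul_one, pow_add_smul, he, ← smul_ideal_smul, ih, ← mul_smul, pow_succ']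
  refine ⟨q, h.exists_eq_jacobson_pow_smul hM hq ⟨e * t + 1, fun hle => ?_⟩⟩
  have := ht.trans hle
  rw [← hpow] at this
  exact (h.jacobson_pow_succ_smul_lt hϖ hM hMne _).not_ge this

/-- The number of radical steps from `M` to `ϖ M` does not depend on the lattice `M`. -/
theorem jacobson_pow_smul_eq_of_eq (h : IsLatticeModule O R D V) {ϖ : O} (hϖ : Irreducible ϖ)
    {M N : Submodule R V} (hM : M.FG) (hMne : M ≠ ⊥) (hN : N.FG) {e : ℕ}
    (he : Ring.jacobson R ^ e • M = algebraMap O D ϖ • M) :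
    Ring.jacobson R ^ e • N = algebraMap O D ϖ • N := by
  rcases eq_or_ne N ⊥ with rfl | hNne
  · simp
  have hϖ0 := algebraMap_ne_zero_of_irreducible (D := D) hϖ
  obtain ⟨q, n, hq⟩ := h.exists_pow_smul_eq hϖ hM hMne hN hNne
  rw [← smul_inj_of_ne_zero (pow_ne_zero q hϖ0), smul_ideal_smul, hq, ← mul_smul, ← pow_succ,
    pow_succ', mul_smul, hq, smul_ideal_smul, ← he, ← pow_add_smul, ← pow_add_smul, add_comm]

end IsLatticeModule

end RadicalSeries

/-! ### The index and the endomorphisms that preserve all lattices -/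

section Index

open Polynomial IsLocalRing
open scoped Pointwise

/-- The elements of the module `P` that are values of homomorphisms from some lattice
`𝔓 ^ k • M`, where `𝔓` is the radical of `R`. For `P = R` they generate `R`, which allows one to
check statements about `R` on lattices. -/
def latticeValues {R V : Type*} [Ring R] [AddCommGroup V] [Module R V] (M : Submodule R V)
    (P : Type*) [AddCommGroup P] [Module R P] : Set P :=
  {y | ∃ (k : ℕ) (φ : (Ring.jacobson R ^ k • M : Submodule R V) →ₗ[R] P)
    (x : (Ring.jacobson R ^ k • M : Submodule R V)), φ x = y}

namespace IsLatticeModule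

/-- A homomorphism `φ` from a lattice to `R` has rank one as a family of endomorphisms of `V`:
there is a `D`-linear form `f` with `φ v • w = f w • v`. -/
theorem exists_linearMap {O R D V : Type*} [CommRing O] [Ring R] [DivisionRing D] [AddCommGroup V]
    [Module O V] [Module R V] [Module D V] [SMulCommClass D R V]
    (h : IsLatticeModule O R D V) {L : Submodule R V} (hne : L ≠ ⊥)
    (φ : L →ₗ[R] R) : ∃ f : V →ₗ[D] D, ∀ (v : L) (w : V), φ v • w = f w • (v : V) := by
  have := SMulCommClass.symm D R V
  obtain ⟨v₀, hv₀, h0⟩ := L.exists_mem_ne_zero_of_ne_bot hne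
  choose f hf using fun w : V => h.exists_hom L (LinearMap.toSpanSingleton R V w ∘ₗ φ)
  simp only [LinearMap.comp_apply, LinearMap.toSpanSingleton_apply] at hf
  refine ⟨{ toFun := f, map_add' := fun w w' => ?_, map_smul' := fun d w => ?_ }, fun v w => hf w v⟩
  · refine smul_left_injective D h0 ?_
    change f (w + w') • v₀ = (f w + f w') • v₀
    rw [← hf (w + w') ⟨v₀, hv₀⟩, add_smul, ← hf w ⟨v₀, hv₀⟩, ← hf w' ⟨v₀, hv₀⟩, smul_add]
  · refine smul_left_injective D h0 ?_
    change f (d • w) • v₀ = (d * f w) • v₀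
    rw [← hf (d • w) ⟨v₀, hv₀⟩, mul_smul, ← hf w ⟨v₀, hv₀⟩, smul_comm]

/-- A dual basis of the projective module `L`. -/
theorem exists_sum_eq_one {O R D V : Type*} [CommRing O] [Ring R] [DivisionRing D] [AddCommGroup V]
    [Module O V] [Module R V] [Module D V] [SMulCommClass D R V]
    (h : IsLatticeModule O R D V) {L : Submodule R V} (hL : L.FG)
    (hne : L ≠ ⊥) : ∃ (s : Finset L) (f : L → (V →ₗ[D] D)),
      (∀ y, ∀ v ∈ L, ∃ r : R, ∀ w, f y w • v = r • w) ∧ ∑ y ∈ s, f y y = 1 := by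
  have := h.projective L hL
  obtain ⟨v₀, hv₀, h0⟩ := L.exists_mem_ne_zero_of_ne_bot hne
  obtain ⟨s, hs⟩ := Module.projective_def'.1 (inferInstance : Module.Projective R L)
  choose f hf using fun y : L => h.exists_linearMap hne (Finsupp.lapply y ∘ₗ s)
  refine ⟨(s ⟨v₀, hv₀⟩).support, f,
    fun y v hv => ⟨_, fun w => (hf y ⟨v, hv⟩ w).symm⟩, smul_left_injective D h0 ?_⟩
  change (∑ y ∈ _, f y y) • v₀ = (1 : D) • v₀
  have h1 := congrArg Subtype.val (LinearMap.congr_fun hs ⟨v₀, hv₀⟩)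
  rw [LinearMap.comp_apply, Finsupp.linearCombination_apply, Finsupp.sum,
    Submodule.coe_sum] at h1
  rw [one_smul, Finset.sum_smul]
  refine Eq.trans (Finset.sum_congr rfl fun y _ => ?_) h1
  rw [← hf y ⟨v₀, hv₀⟩ y]
  rfl

end IsLatticeModule

variable {O R D V : Type*} [CommRing O] [Ring R] [Algebra O R] [DivisionRing D] [Algebra O D]
  [AddCommGroup V] [Module O V] [Module R V] [Module D V] [IsScalarTower O R V]
  [IsScalarTower O D V] [SMulCommClass D R V]

namespace IsLatticeModule

theorem smul_eq_of_isIndex {ϖ : O} {e : ℕ} (he : IsIndex R ϖ e) (M : Submodule R V) :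
    Ring.jacobson R ^ e • M = algebraMap O D ϖ • M := by
  rw [he.2]
  have hsm : ∀ x : V, algebraMap O D ϖ • x = algebraMap O R ϖ • x := fun x => by
    rw [algebraMap_smul, algebraMap_smul]
  refine le_antisymm (Submodule.smul_le.2 fun r hr x hx => ?_) ?_
  · obtain ⟨s, rfl⟩ := Ideal.mem_span_singleton'.1 hr
    rw [← Algebra.commutes, mul_smul, ← hsm]
    exact Submodule.smul_mem_pointwise_smul _ _ _ (M.smul_mem _ hx)
  · rintro _ ⟨x, hx, rfl⟩
    change algebraMap O D ϖ • x ∈ _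
    rw [hsm]
    exact Submodule.smul_mem_smul (Ideal.mem_span_singleton_self _) hx

variable [IsDomain O] [IsDiscreteValuationRing O] [HenselianLocalRing O] [Module.Finite O R]

/-- The elements of `D` that preserve a lattice are those integral over `O`. -/
theorem smul_le_iff_isIntegral (h : IsLatticeModule O R D V) {L : Submodule R V} (hL : L.FG)
    (hne : L ≠ ⊥) {d : D} : d • L ≤ L ↔ IsIntegral O d := by
  refine ⟨fun hd => isIntegral_of_smul_mem hL hne fun x hx =>
    hd (Submodule.smul_mem_pointwise_smul _ _ _ hx), fun hd => ?_⟩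
  rcases eq_or_ne d 0 with rfl | hd0
  · simp
  rcases h.le_total (fg_smul hL d) hL with hle | hle
  · exact hle
  -- If `L ≤ d • L`, then the equation for `d` gives `d ^ n • L ≤ d ^ (n - 1) • L`.
  have hmono : Monotone fun k : ℕ => d ^ k • L := monotone_nat_of_le_succ fun k => by
    rw [pow_succ, mul_smul]
    exact (smul_le_smul_iff_of_ne_zero (pow_ne_zero k hd0)).2 hle
  obtain ⟨p, hp, hp0⟩ := hd
  have hdeg : p.natDegree ≠ 0 := fun h0 => by
    rw [hp.natDegree_eq_zero.1 h0, eval₂_one] at hp0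
    exact one_ne_zero hp0
  obtain ⟨n, hn⟩ := Nat.exists_eq_succ_of_ne_zero hdeg
  have hlead : p.coeff (n + 1) = 1 := by
    rw [← Nat.succ_eq_add_one, ← hn]
    exact hp.coeff_natDegree
  rw [eval₂_eq_sum_range, hn, Finset.sum_range_succ, hlead, map_one, one_mul] at hp0
  rw [← smul_le_smul_iff_of_ne_zero (pow_ne_zero n hd0), ← mul_smul, ← pow_succ]
  rintro _ ⟨x, hx, rfl⟩
  change d ^ (n + 1) • x ∈ _
  rw [← neg_eq_of_add_eq_zero_right hp0, neg_smul, Finset.sum_smul]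
  refine neg_mem (sum_mem fun k hk => ?_)
  rw [mul_smul, algebraMap_smul, ← algebraMap_smul R]
  exact Submodule.smul_mem _ _
    (hmono (Nat.lt_succ_iff.1 (Finset.mem_range.1 hk)) (Submodule.smul_mem_pointwise_smul _ _ _ hx))

variable [FaithfulSMul O D]

/-- A finitely generated submodule of a power of `V` is generated by the images of lattices,
because the image of one of its coordinate projections is projective, hence splits off. -/
theorem closure_latticeValues_of_injective (h : IsLatticeModule O R D V) {ϖ : O}
    (hϖ : Irreducible ϖ) {M : Submodule R V} (hM : M.FG) (hne : M ≠ ⊥) (n : ℕ) (P : Type*)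
    [AddCommGroup P] [Module R P] [Module.Finite R P] (j : P →ₗ[R] (Fin n → V))
    (hj : Function.Injective j) : AddSubmonoid.closure (latticeValues M P) = ⊤ := by
  have := isNoetherianRing_of_finite_algebra O R
  induction n generalizing P with
  | zero =>
    refine eq_top_iff.2 fun y _ => ?_
    rw [hj (Subsingleton.elim (j y) (j 0))]
    exact zero_mem _
  | succ n ih =>
    let p : P →ₗ[R] V := LinearMap.proj 0 ∘ₗ j
    have hfg : (LinearMap.range p).FG := by
      rw [LinearMap.range_eq_map]
      exact Module.Finite.fg_top.map p
    have := h.projective _ hfg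
    obtain ⟨s, hs⟩ := Module.projective_lifting_property p.rangeRestrict LinearMap.id
      p.surjective_rangeRestrict
    have hps : ∀ l, p (s l) = l := fun l => congrArg Subtype.val (LinearMap.congr_fun hs l)
    have hker := ih (LinearMap.ker p)
      (LinearMap.pi fun i => LinearMap.proj i.succ ∘ₗ j ∘ₗ (LinearMap.ker p).subtype) (by
        intro x y hxy
        refine Subtype.ext (hj (funext fun i => ?_))
        refine Fin.cases ?_ (fun i => congrFun hxy i) i
        exact (LinearMap.mem_ker.1 x.2).trans (LinearMap.mem_ker.1 y.2).symm)
    refine eq_top_iff.2 fun y _ => ?_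
    have h1 : s (p.rangeRestrict y) ∈ AddSubmonoid.closure (latticeValues M P) := by
      by_cases hL : LinearMap.range p = ⊥
      · have : p.rangeRestrict y = 0 := by
          have hy : p y ∈ LinearMap.range p := ⟨y, rfl⟩
          rw [hL] at hy
          exact Subtype.ext hy
        rw [this, map_zero]
        exact zero_mem _
      obtain ⟨q, k, hqk⟩ := h.exists_pow_smul_eq hϖ hM hne hfg hL
      have hϖ0 := pow_ne_zero q (algebraMap_ne_zero_of_irreducible (D := D) hϖ)
      let d := (algebraMap O D ϖ ^ q)⁻¹
      have hd : ∀ x ∈ Ring.jacobson R ^ k • M, d • x ∈ LinearMap.range p := fun x hx => by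
        rw [← hqk] at hx
        obtain ⟨z, hz, rfl⟩ := hx
        change d • algebraMap O D ϖ ^ q • z ∈ _
        rwa [inv_smul_smul₀ hϖ0]
      refine AddSubmonoid.subset_closure ⟨k,
        s ∘ₗ (DistribSMul.toLinearMap R V d).restrict hd,
        ⟨algebraMap O D ϖ ^ q • p.rangeRestrict y, ?_⟩, ?_⟩
      · rw [← hqk]
        exact Submodule.smul_mem_pointwise_smul _ _ _ (p.rangeRestrict y).2
      · refine congrArg s (Subtype.ext ?_)
        change d • algebraMap O D ϖ ^ q • (p.rangeRestrict y : V) = _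
        rw [inv_smul_smul₀ hϖ0]
    have h2 : y - s (p.rangeRestrict y) ∈ AddSubmonoid.closure (latticeValues M P) := by
      have hmem : y - s (p.rangeRestrict y) ∈ LinearMap.ker p := by
        rw [LinearMap.mem_ker, map_sub, hps, sub_eq_zero]
        rfl
      have h3 : (⟨_, hmem⟩ : LinearMap.ker p) ∈ AddSubmonoid.closure (latticeValues M _) := by
        rw [hker]; trivial
      have h4 := AddSubmonoid.mem_map_of_mem (LinearMap.ker p).subtype.toAddMonoidHom h3
      rw [AddMonoidHom.map_mclosure] at h4
      refine AddSubmonoid.closure_mono ?_ h4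
      rintro _ ⟨_, ⟨k, φ, x, rfl⟩, rfl⟩
      exact ⟨k, (LinearMap.ker p).subtype ∘ₗ φ, x, rfl⟩
    simpa using add_mem h1 h2

theorem closure_latticeValues (h : IsLatticeModule O R D V) {ϖ : O}
    (hϖ : Irreducible ϖ) {M : Submodule R V} (hM : M.FG) (hne : M ≠ ⊥) :
    AddSubmonoid.closure (latticeValues M R) = ⊤ := by
  obtain ⟨n, j, hj⟩ := h.exists_embedding
  exact h.closure_latticeValues_of_injective hϖ hM hne n R j hj

/-- If `e` is the number of radical steps from `M` to `ϖ M`, then it is the index of `R`. -/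
theorem isIndex_of_smul_eq (h : IsLatticeModule O R D V) {ϖ : O}
    (hϖ : Irreducible ϖ) {M : Submodule R V} (hM : M.FG) (hne : M ≠ ⊥) {e : ℕ} (he0 : 0 < e)
    (he : Ring.jacobson R ^ e • M = algebraMap O D ϖ • M) : IsIndex R ϖ e := by
  have := isNoetherianRing_of_finite_algebra O R
  have hgen := h.closure_latticeValues hϖ hM hne
  have hstep : ∀ k, Ring.jacobson R ^ e • Ring.jacobson R ^ k • M =
      algebraMap O D ϖ • Ring.jacobson R ^ k • M := fun k =>
    h.jacobson_pow_smul_eq_of_eq hϖ hM hne (fg_ideal_smul _ hM) he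
  have h2s : (Ring.jacobson R ^ e).IsTwoSided := inferInstance
  refine ⟨he0, le_antisymm (fun a ha => ?_) ?_⟩
  · have key : ∀ r : R, a * r ∈ Ideal.span {algebraMap O R ϖ} := fun r => by
      have hr : r ∈ AddSubmonoid.closure (latticeValues M R) := hgen ▸ trivial
      induction hr using AddSubmonoid.closure_induction with
      | zero => simp
      | add r s _ _ hr hs => rw [mul_add]; exact add_mem hr hs
      | mem r hr =>
        obtain ⟨k, φ, x, rfl⟩ := hr
        have hax : a • (x : V) ∈ algebraMap O D ϖ • Ring.jacobson R ^ k • M := by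
          rw [← hstep]; exact Submodule.smul_mem_smul ha x.2
        obtain ⟨y, hy, hyx⟩ := hax
        have hyx' : a • x =
            algebraMap O R ϖ • (⟨y, hy⟩ : (Ring.jacobson R ^ k • M : Submodule R V)) := by
          refine Subtype.ext ?_
          change a • (x : V) = algebraMap O R ϖ • y
          rw [← hyx, algebraMap_smul]
          exact algebraMap_smul D ϖ y
        rw [← smul_eq_mul, ← map_smul, hyx', map_smul, smul_eq_mul, Algebra.commutes]
        exact Ideal.mul_mem_left _ _ (Ideal.mem_span_singleton_self _)
    simpa using key 1
  · rw [Ideal.span_le, Set.singleton_subset_iff]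
    have key : ∀ r : R, algebraMap O R ϖ * r ∈ Ring.jacobson R ^ e := fun r => by
      have hr : r ∈ AddSubmonoid.closure (latticeValues M R) := hgen ▸ trivial
      induction hr using AddSubmonoid.closure_induction with
      | zero => simp
      | add r s _ _ hr hs => rw [mul_add]; exact add_mem hr hs
      | mem r hr =>
        obtain ⟨k, φ, x, rfl⟩ := hr
        let L := Ring.jacobson R ^ k • M
        have hx : algebraMap O R ϖ • x ∈ (Ring.jacobson R ^ e • ⊤ : Submodule R L) := by
          have h1 : ((algebraMap O R ϖ • x : L) : V) ∈ Ring.jacobson R ^ e • L := by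
            rw [hstep]
            have : ((algebraMap O R ϖ • x : L) : V) = algebraMap O D ϖ • (x : V) := by
              rw [Submodule.coe_smul, algebraMap_smul, algebraMap_smul]
            rw [this]
            exact Submodule.smul_mem_pointwise_smul _ _ _ x.2
          have h2 : Ring.jacobson R ^ e • L =
              (Ring.jacobson R ^ e • ⊤ : Submodule R L).map L.subtype := by
            rw [Submodule.map_smul'', Submodule.map_subtype_top]
          rw [h2] at h1
          obtain ⟨z, hz, hzx⟩ := h1
          rwa [← Subtype.ext hzx]
        have h3 := Submodule.mem_map_of_mem (f := φ) hx
        rw [Submodule.map_smul'', map_smul, smul_eq_mul] at h3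
        exact (Submodule.smul_le.2 fun r hr s _ => h2s.mul_mem_of_left _ hr) h3
    simpa using key 1

theorem exists_isIndex (h : IsLatticeModule O R D V) [Nontrivial V] {ϖ : O}
    (hϖ : Irreducible ϖ) : ∃ e, IsIndex R ϖ e := by
  obtain ⟨v, hv⟩ := exists_ne (0 : V)
  have hM : (Submodule.span R {v}).FG := Submodule.fg_span_singleton v
  have hne : Submodule.span R {v} ≠ ⊥ := by simpa using hv
  obtain ⟨e, he0, he⟩ := h.exists_jacobson_pow_smul_eq hϖ hM hne
  exact ⟨e, h.isIndex_of_smul_eq hϖ hM hne he0 he⟩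

/-- `R` consists of all `D`-linear endomorphisms of `V` that preserve the lattices. -/
theorem exists_eq_smul (h : IsLatticeModule O R D V) {ϖ : O} (hϖ : Irreducible ϖ)
    {M : Submodule R V} (hM : M.FG) (hne : M ≠ ⊥) (T : V →ₗ[D] V)
    (hT : ∀ k, ∀ x ∈ Ring.jacobson R ^ k • M, T x ∈ Ring.jacobson R ^ k • M) :
    ∃ r : R, ∀ w, T w = r • w := by
  suffices key : ∀ s : R, ∃ r : R, ∀ w, T (s • w) = r • w by simpa using key 1
  intro s
  have hs : s ∈ AddSubmonoid.closure (latticeValues M R) :=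
    h.closure_latticeValues hϖ hM hne ▸ trivial
  induction hs using AddSubmonoid.closure_induction with
  | zero => exact ⟨0, by simp⟩
  | add s t _ _ hs ht =>
    obtain ⟨r, hr⟩ := hs
    obtain ⟨r', hr'⟩ := ht
    exact ⟨r + r', fun w => by rw [add_smul, map_add, hr, hr', add_smul]⟩
  | mem s hs =>
    obtain ⟨k, φ, x, rfl⟩ := hs
    obtain ⟨f, hf⟩ := h.exists_linearMap (h.jacobson_pow_smul_ne_bot hϖ hM hne k) φ
    exact ⟨φ ⟨T x, hT k x x.2⟩, fun w => by rw [hf, map_smul, hf]⟩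

/-- Whether `d` maps a radical power of a lattice into another one only depends on `D` and the
index. Raised to the power `e`, the condition is that `d ^ e ϖ ^ i` maps `M` into `ϖ ^ j M`, as
`𝔓 ^ e = ϖ R`. -/
theorem smul_jacobson_pow_smul_le_iff (h : IsLatticeModule O R D V) {ϖ : O} (hϖ : Irreducible ϖ)
    {M : Submodule R V} (hM : M.FG) (hne : M ≠ ⊥) {e : ℕ} (he : IsIndex R ϖ e) {d : D}
    (hd : d ≠ 0) (i j : ℕ) :
    d • Ring.jacobson R ^ i • M ≤ Ring.jacobson R ^ j • M ↔
      IsIntegral O (d ^ e * algebraMap O D ϖ ^ i * (algebraMap O D ϖ ^ j)⁻¹) := by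
  set p := algebraMap O D ϖ with hp
  have hp0 : p ≠ 0 := algebraMap_ne_zero_of_irreducible hϖ
  have hpe : ∀ N : Submodule R V, p • N = Ring.jacobson R ^ e • N := fun N =>
    (smul_eq_of_isIndex he N).symm
  have hpow : ∀ (t : ℕ) (N : Submodule R V), p ^ t • N = Ring.jacobson R ^ (e * t) • N := by
    intro t N
    induction t with
    | zero => simp [Submodule.pow_zero, Ideal.one_eq_top]
    | succ t ih =>
      rw [pow_succ', mul_smul, ih, hpe, mul_add, mul_one, add_comm, pow_add_smul]
  obtain ⟨q, n, hqn⟩ := h.exists_pow_smul_eq hϖ hM hne (fg_smul hM d) (smul_ne_bot hne hd)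
  have hlhs : d • Ring.jacobson R ^ i • M ≤ Ring.jacobson R ^ j • M ↔ e * q + j ≤ i + n := by
    rw [← smul_le_smul_iff_of_ne_zero (pow_ne_zero q hp0), smul_ideal_smul, smul_ideal_smul, hqn,
      hpow, ← pow_add_smul, ← pow_add_smul, h.jacobson_pow_smul_le_iff hϖ hM hne]
  have hcomm : ∀ x : D, Commute p x := fun x => Algebra.commutes ϖ x
  have hdpow : ∀ a : ℕ, p ^ (q * a) • d ^ a • M = Ring.jacobson R ^ (n * a) • M := by
    intro a
    induction a with
    | zero => simp [Submodule.pow_zero, Ideal.one_eq_top]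
    | succ a ih =>
      have : p ^ (q * (a + 1)) * d ^ (a + 1) = (p ^ q * d) * (p ^ (q * a) * d ^ a) := by
        rw [pow_succ', mul_add, mul_one, add_comm, pow_add, mul_assoc, mul_assoc,
          ← mul_assoc (p ^ (q * a)), ((hcomm d).pow_left (q * a)).eq, mul_assoc]
      rw [← mul_smul, this, mul_smul, mul_smul (p ^ (q * a)), ih, mul_smul, smul_ideal_smul,
        smul_ideal_smul, hqn, ← pow_add_smul, mul_add, mul_one]
  rw [hlhs, ← h.smul_le_iff_isIntegral (O := O) hM hne,
    ← smul_le_smul_iff_of_ne_zero (pow_ne_zero (q * e + j) hp0)]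
  have hx : p ^ (q * e + j) * (d ^ e * p ^ i * (p ^ j)⁻¹) = p ^ i * (p ^ (q * e) * d ^ e) := by
    have h1 : Commute (p ^ j) (d ^ e * p ^ i) := (hcomm _).pow_left j
    rw [pow_add, mul_assoc, ← mul_assoc (p ^ j), h1.eq, mul_assoc (d ^ e * p ^ i),
      mul_inv_cancel₀ (pow_ne_zero j hp0), mul_one, ((hcomm (d ^ e)).pow_left i).eq.symm,
      ← mul_assoc, ← mul_assoc, ← pow_add, ← pow_add, add_comm]
  rw [← mul_smul, hx, mul_smul, mul_smul, hdpow, hpow, hpow, ← pow_add_smul,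
    h.jacobson_pow_smul_le_iff hϖ hM hne, mul_comm n, ← mul_add, Nat.mul_le_mul_left_iff he.1,
    mul_comm e q]

end IsLatticeModule

end Index

/-! ### Morita contexts -/

section MoritaContexts

open MulOpposite

section Balanced

variable {O B I J : Type*} [CommRing O] [Ring B] [AddCommGroup I] [Module O I] [Module Bᵐᵒᵖ I]
  [AddCommGroup J] [Module O J] [Module B J]

theorem balancedTmul_op_smul (b : B) (i : I) (j : J) :
    balancedTmul O B (op b • i) j = balancedTmul O B i (b • j) :=
  (Submodule.Quotient.eq _).2 (Submodule.subset_span ⟨_, _, _, rfl⟩)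

/-- The bilinear pairing that corresponds to a homomorphism on `I ⊗_B J`. -/
def balancedPairing {M : Type*} [AddCommGroup M] [Module O M] (f : BalancedTensor O B I J →ₗ[O] M) :
    I →ₗ[O] J →ₗ[O] M :=
  TensorProduct.curry (f ∘ₗ Submodule.mkQ _)

theorem lift_balancedPairing {M : Type*} [AddCommGroup M] [Module O M]
    (f : BalancedTensor O B I J →ₗ[O] M) (t : TensorProduct O I J) :
    TensorProduct.lift (balancedPairing f) t = f (Submodule.Quotient.mk t) := by
  induction t using TensorProduct.induction_on with
  | zero => simp
  | add s t hs ht => rw [map_add, hs, ht, Submodule.Quotient.mk_add, map_add]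
  | tmul i j => rfl

/-- A balanced pairing takes the same value on tensors that agree in `I ⊗_B J`. -/
theorem lift_eq_of_balanced {M : Type*} [AddCommGroup M] [Module O M]
    (h : I →ₗ[O] J →ₗ[O] M) (hh : ∀ (b : B) i j, h (op b • i) j = h i (b • j))
    {s t : TensorProduct O I J}
    (hst : (Submodule.Quotient.mk s : BalancedTensor O B I J) = Submodule.Quotient.mk t) :
    TensorProduct.lift h s = TensorProduct.lift h t := by
  have hle : balancedRel O B I J ≤ LinearMap.ker (TensorProduct.lift h) := by
    refine Submodule.span_le.2 ?_
    rintro _ ⟨i, b, j, rfl⟩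
    simp [hh]
  rw [Submodule.Quotient.eq] at hst
  rw [← sub_eq_zero, ← map_sub]
  exact hle hst

end Balanced

/-- A Morita context: an `A`-`B`-bimodule `I` and a `B`-`A`-bimodule `J` with balanced bilinear
pairings `I × J → A` and `J × I → B` that satisfy the two associativity laws and whose values
generate `A` and `B`. -/
structure MoritaContext (O A B I J : Type*) [CommRing O] [Ring A] [Algebra O A] [Ring B]
    [Algebra O B] [AddCommGroup I] [Module O I] [Module A I] [Module Bᵐᵒᵖ I]
    [AddCommGroup J] [Module O J] [Module B J] [Module Aᵐᵒᵖ J] where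
  /-- The pairing with values in `A`. -/
  p : I →ₗ[O] J →ₗ[O] A
  /-- The pairing with values in `B`. -/
  q : J →ₗ[O] I →ₗ[O] B
  p_smul : ∀ (a : A) i j, p (a • i) j = a * p i j
  p_op_smul : ∀ (a : A) i j, p i (op a • j) = p i j * a
  q_smul : ∀ (b : B) j i, q (b • j) i = b * q j i
  q_op_smul : ∀ (b : B) j i, q j (op b • i) = q j i * b
  p_balanced : ∀ (b : B) i j, p (op b • i) j = p i (b • j)
  q_balanced : ∀ (a : A) j i, q (op a • j) i = q j (a • i)
  p_assoc : ∀ i j i', p i j • i' = op (q j i') • i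
  q_assoc : ∀ j i j', q j i • j' = op (p i j') • j
  p_unit : ∃ t, TensorProduct.lift p t = 1
  q_unit : ∃ t, TensorProduct.lift q t = 1

variable {O A B I J : Type*} [CommRing O] [Ring A] [Algebra O A] [Ring B]
    [Algebra O B] [AddCommGroup I] [Module O I] [Module A I] [Module Bᵐᵒᵖ I]
    [AddCommGroup J] [Module O J] [Module B J] [Module Aᵐᵒᵖ J]

namespace MoritaContext

/-- The Morita context with the roles of the two rings exchanged. -/
def symm (c : MoritaContext O A B I J) : MoritaContext O B A J I where
  p := c.q
  q := c.p
  p_smul := c.q_smul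
  p_op_smul := c.q_op_smul
  q_smul := c.p_smul
  q_op_smul := c.p_op_smul
  p_balanced := c.q_balanced
  q_balanced := c.p_balanced
  p_assoc := c.q_assoc
  q_assoc := c.p_assoc
  p_unit := c.q_unit
  q_unit := c.p_unit

/-- A pairing in a Morita context is an isomorphism: if `∑ p i' j' = 1`, then
`i ⊗ j = ∑ i ⊗ j (p i' j') = ∑ i ⊗ (q j i') j' = ∑ i (q j i') ⊗ j' = ∑ (p i j) i' ⊗ j'` is
determined by `p i j`. -/
theorem hasBimoduleIso (c : MoritaContext O A B I J) (hI : IsBimodule O A B I) :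
    HasBimoduleIso O A B I J := by
  have := hI.left_compat
  obtain ⟨t, ht⟩ := c.p_unit
  let l : A → I →ₗ[O] I := fun a => Module.toModuleEnd O I a
  let L : A →ₗ[O] TensorProduct O I J →ₗ[O] TensorProduct O I J :=
    { toFun := fun a => LinearMap.rTensor J (l a)
      map_add' := fun a b => TensorProduct.ext' fun i j => by
        simp [l, add_smul, TensorProduct.add_tmul]
      map_smul' := fun r a => TensorProduct.ext' fun i j => by
        simp [l, TensorProduct.smul_tmul'] }
  let P : BalancedTensor O B I J →ₗ[O] A := Submodule.liftQ _ (TensorProduct.lift c.p) (by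
    refine Submodule.span_le.2 ?_
    rintro _ ⟨i, b, j, rfl⟩
    simp [c.p_balanced])
  have hP : ∀ i j, P (balancedTmul O B i j) = c.p i j := fun i j => rfl
  have key : ∀ (i : I) (j : J) (s : TensorProduct O I J),
      balancedTmul O B i (op (TensorProduct.lift c.p s) • j) =
        Submodule.Quotient.mk (L (c.p i j) s) := by
    intro i j s
    induction s using TensorProduct.induction_on with
    | zero => simp [balancedTmul]
    | add s s' hs hs' =>
      rw [map_add, map_add, Submodule.Quotient.mk_add, ← hs, ← hs', op_add, add_smul]
      simp [balancedTmul, TensorProduct.tmul_add]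
    | tmul i' j' =>
      rw [TensorProduct.lift.tmul, ← c.q_assoc]
      change _ = Submodule.Quotient.mk ((c.p i j • i') ⊗ₜ[O] j')
      rw [c.p_assoc]
      exact (balancedTmul_op_smul (c.q j i') i j').symm
  have key' : ∀ u : TensorProduct O I J, (Submodule.Quotient.mk u : BalancedTensor O B I J) =
      Submodule.Quotient.mk (L (TensorProduct.lift c.p u) t) := by
    intro u
    induction u using TensorProduct.induction_on with
    | zero => simp
    | add u v hu hv =>
      rw [Submodule.Quotient.mk_add, hu, hv, map_add, map_add, LinearMap.add_apply,
        Submodule.Quotient.mk_add]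
    | tmul i j =>
      have := key i j t
      rw [ht, op_one, one_smul] at this
      exact this
  refine ⟨LinearEquiv.ofBijective P ⟨?_, fun a => ?_⟩, fun a i j => ?_⟩
  · rw [← LinearMap.ker_eq_bot, LinearMap.ker_eq_bot']
    intro u hu
    obtain ⟨u, rfl⟩ := Submodule.Quotient.mk_surjective _ u
    have hu' : TensorProduct.lift c.p u = 0 := hu
    rw [key', hu', map_zero, LinearMap.zero_apply, Submodule.Quotient.mk_zero]
  · refine ⟨Submodule.Quotient.mk (L a t), ?_⟩
    have : ∀ s : TensorProduct O I J,
        TensorProduct.lift c.p (L a s) = a * TensorProduct.lift c.p s := fun s => by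
      induction s using TensorProduct.induction_on with
      | zero => simp
      | add s s' hs hs' => rw [map_add, map_add, hs, hs', map_add, mul_add]
      | tmul i j => exact c.p_smul a i j
    exact (this t).trans (by rw [ht, mul_one])
  · exact ⟨c.p_smul a i j, c.p_op_smul a i j⟩

end MoritaContext

/-- Bimodule isomorphisms `f : I ⊗_B J ≅ A` and `g : J ⊗_A I ≅ B` need not be compatible, but
they become so after twisting `g` by the automorphism `τ` of `I` that corresponds to
`I ≅ I ⊗_B (J ⊗_A I) ≅ (I ⊗_B J) ⊗_A I ≅ I`. -/
theorem exists_moritaContext (hI : IsBimodule O A B I) (hJ : IsBimodule O B A J)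
    (hf : HasBimoduleIso O A B I J) (hg : HasBimoduleIso O B A J I) :
    Nonempty (MoritaContext O A B I J) := by
  have := hI.left_compat
  have := hI.right_compat
  have := hI.comm
  have := hJ.left_compat
  have := hJ.right_compat
  have := hJ.comm
  obtain ⟨f, hf⟩ := hf
  obtain ⟨g, hg⟩ := hg
  let p := balancedPairing f.toLinearMap
  let q := balancedPairing g.toLinearMap
  have p_smul : ∀ (a : A) i j, p (a • i) j = a * p i j := fun a i j => (hf a i j).1
  have p_op_smul : ∀ (a : A) i j, p i (op a • j) = p i j * a := fun a i j => (hf a i j).2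
  have q_smul : ∀ (b : B) j i, q (b • j) i = b * q j i := fun b j i => (hg b j i).1
  have q_op_smul : ∀ (b : B) j i, q j (op b • i) = q j i * b := fun b j i => (hg b j i).2
  have p_bal : ∀ (b : B) i j, p (op b • i) j = p i (b • j) := fun b i j =>
    congrArg f (balancedTmul_op_smul b i j)
  have q_bal : ∀ (a : A) j i, q (op a • j) i = q j (a • i) := fun a j i =>
    congrArg g (balancedTmul_op_smul a j i)
  have p_inj : ∀ s t : TensorProduct O I J, TensorProduct.lift p s = TensorProduct.lift p t →
      (Submodule.Quotient.mk s : BalancedTensor O B I J) = Submodule.Quotient.mk t := by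
    intro s t h
    rw [lift_balancedPairing, lift_balancedPairing] at h
    exact f.injective h
  have q_inj : ∀ s t : TensorProduct O J I, TensorProduct.lift q s = TensorProduct.lift q t →
      (Submodule.Quotient.mk s : BalancedTensor O A J I) = Submodule.Quotient.mk t := by
    intro s t h
    rw [lift_balancedPairing, lift_balancedPairing] at h
    exact g.injective h
  obtain ⟨s, hs⟩ : ∃ s, TensorProduct.lift p s = 1 := by
    obtain ⟨s, hs⟩ := Submodule.Quotient.mk_surjective _ (f.symm 1)
    exact ⟨s, by rw [lift_balancedPairing, hs]; exact f.apply_symm_apply 1⟩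
  obtain ⟨t, ht⟩ : ∃ t, TensorProduct.lift q t = 1 := by
    obtain ⟨t, ht⟩ := Submodule.Quotient.mk_surjective _ (g.symm 1)
    exact ⟨t, by rw [lift_balancedPairing, ht]; exact g.apply_symm_apply 1⟩
  let lA : A →ₗ[O] I →ₗ[O] I := (Algebra.lsmul O O I).toLinearMap
  let rB : B →ₗ[O] I →ₗ[O] I :=
    (Algebra.lsmul O O I : Bᵐᵒᵖ →ₐ[O] _).toLinearMap ∘ₗ (opLinearEquiv O).toLinearMap
  let lB : B →ₗ[O] J →ₗ[O] J := (Algebra.lsmul O O J).toLinearMap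
  -- `h i j i' = p i j • i'` and `k i i' j' = i' q j' i`
  let h : I →ₗ[O] J →ₗ[O] I →ₗ[O] I := LinearMap.compr₂ p lA
  have h_apply : ∀ i j i', h i j i' = p i j • i' := fun i j i' => rfl
  have h_bal : ∀ i₀ (a : A) j i, h i₀ (op a • j) i = h i₀ j (a • i) := fun i₀ a j i => by
    rw [h_apply, h_apply, p_op_smul, mul_smul]
  let k : I → I →ₗ[O] J →ₗ[O] I := fun i => LinearMap.flip (rB ∘ₗ q.flip i)
  have k_apply : ∀ i i' j', k i i' j' = op (q j' i) • i' := fun i i' j' => rfl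
  have k_bal : ∀ i₀ (b : B) i j, k i₀ (op b • i) j = k i₀ i (b • j) := fun i₀ b i j => by
    rw [k_apply, k_apply, q_smul, op_mul, mul_smul]
  let τ : I →ₗ[O] I := ((TensorProduct.lift.equiv (.id O) J I I).toLinearMap ∘ₗ h).flip t
  have τ_apply : ∀ i, τ i = TensorProduct.lift (h i) t := fun i => rfl
  let ρ : I → I := fun i => TensorProduct.lift (k i) s
  have τ_left : ∀ (a : A) i, τ (a • i) = a • τ i := fun a i => by
    rw [τ_apply, τ_apply]
    have : ∀ u, TensorProduct.lift (h (a • i)) u = a • TensorProduct.lift (h i) u := fun u => by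
      induction u using TensorProduct.induction_on with
      | zero => simp
      | add u v hu hv => rw [map_add, map_add, hu, hv, smul_add]
      | tmul j i' => simp only [TensorProduct.lift.tmul, h_apply, p_smul, mul_smul]
    exact this t
  have τ_op : ∀ (b : B) i u, TensorProduct.lift q u = b →
      τ (op b • i) = TensorProduct.lift (h i) u := by
    intro b i u hu
    have h1 : ∀ v, TensorProduct.lift (h (op b • i)) v =
        TensorProduct.lift (h i) (LinearMap.rTensor I (lB b) v) ∧
        TensorProduct.lift q (LinearMap.rTensor I (lB b) v) = b * TensorProduct.lift q v := by
      intro v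
      induction v using TensorProduct.induction_on with
      | zero => simp
      | add u v hu hv =>
        simp only [map_add, hu.1, hv.1, hu.2, hv.2, mul_add, and_self]
      | tmul j i' =>
        rw [LinearMap.rTensor_tmul]
        simp only [TensorProduct.lift.tmul, h_apply, p_bal]
        exact ⟨rfl, q_smul b j i'⟩
    rw [τ_apply, (h1 t).1]
    refine lift_eq_of_balanced (h i) (h_bal i) (q_inj _ _ ?_)
    rw [(h1 t).2, ht, mul_one, hu]
  have τ_q : ∀ j i i₀, τ (op (q j i) • i₀) = p i₀ j • i := fun j i i₀ =>
    τ_op _ i₀ (j ⊗ₜ[O] i) rfl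
  have τ_right : ∀ (b : B) i, τ (op b • i) = op b • τ i := fun b i => by
    have h1 : ∀ v, TensorProduct.lift (h i) (LinearMap.lTensor J (rB b) v) =
          op b • TensorProduct.lift (h i) v ∧
        TensorProduct.lift q (LinearMap.lTensor J (rB b) v) = TensorProduct.lift q v * b := by
      intro v
      induction v using TensorProduct.induction_on with
      | zero => simp
      | add u v hu hv =>
        simp only [map_add, hu.1, hv.1, hu.2, hv.2, add_mul, smul_add, and_self]
      | tmul j i' =>
        rw [LinearMap.lTensor_tmul]
        exact ⟨smul_comm (p i j) (op b) i', q_op_smul b j i'⟩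
    rw [τ_op b i _ (by rw [(h1 t).2, ht, one_mul]), (h1 t).1, τ_apply]
  have ρ_p : ∀ i j i₀, ρ (p i j • i₀) = op (q j i₀) • i := by
    intro i j i₀
    let rA : A →ₗ[O] J →ₗ[O] J :=
      (Algebra.lsmul O O J : Aᵐᵒᵖ →ₐ[O] _).toLinearMap ∘ₗ (opLinearEquiv O).toLinearMap
    have h1 : ∀ (a : A) v, TensorProduct.lift (k (a • i₀)) v =
        TensorProduct.lift (k i₀) (LinearMap.lTensor I (rA a) v) ∧
        TensorProduct.lift p (LinearMap.lTensor I (rA a) v) = TensorProduct.lift p v * a := by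
      intro a v
      induction v using TensorProduct.induction_on with
      | zero => simp
      | add u v hu hv =>
        simp only [map_add, hu.1, hv.1, hu.2, hv.2, add_mul, and_self]
      | tmul i' j' =>
        rw [LinearMap.lTensor_tmul]
        simp only [TensorProduct.lift.tmul, k_apply, ← q_bal]
        exact ⟨rfl, p_op_smul a i' j'⟩
    change TensorProduct.lift (k (p i j • i₀)) s = _
    rw [(h1 _ s).1]
    refine lift_eq_of_balanced (t := i ⊗ₜ[O] j) (k i₀) (k_bal i₀) (p_inj _ _ ?_)
    rw [(h1 _ s).2, hs, one_mul, TensorProduct.lift.tmul]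
  have τρ : ∀ i, τ (ρ i) = i := fun i => by
    have : ∀ u, τ (TensorProduct.lift (k i) u) = TensorProduct.lift p u • i := fun u => by
      induction u using TensorProduct.induction_on with
      | zero => simp
      | add u v hu hv => rw [map_add, map_add, hu, hv, map_add, add_smul]
      | tmul i' j' => exact τ_q j' i i'
    exact (this s).trans (by rw [hs, one_smul])
  have ρ_add : ∀ x y, ρ (x + y) = ρ x + ρ y := fun x y => by
    have : ∀ u, TensorProduct.lift (k (x + y)) u =
        TensorProduct.lift (k x) u + TensorProduct.lift (k y) u := fun u => by
      induction u using TensorProduct.induction_on with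
      | zero => simp
      | add u v hu hv => rw [map_add, map_add, map_add, hu, hv, add_add_add_comm]
      | tmul i' j' => simp only [TensorProduct.lift.tmul, k_apply, map_add, op_add, add_smul]
    exact this s
  have ρτ : ∀ i, ρ (τ i) = i := fun i => by
    have h0 : ρ 0 = 0 := by simpa using ρ_add 0 0
    have : ∀ u, ρ (TensorProduct.lift (h i) u) = op (TensorProduct.lift q u) • i := fun u => by
      induction u using TensorProduct.induction_on with
      | zero => simp [h0]
      | add u v hu hv => rw [map_add, ρ_add, hu, hv, map_add, op_add, add_smul]
      | tmul j i' => exact ρ_p i j i'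
    exact (this t).trans (by rw [ht, op_one, one_smul])
  let τe : I ≃ₗ[O] I := LinearEquiv.ofBijective τ
    ⟨Function.LeftInverse.injective ρτ, Function.RightInverse.surjective τρ⟩
  have p_assoc : ∀ i j i', p i j • i' = op (q j (τ i')) • i := fun i j i' => by
    rw [← ρ_p, ← τ_left, ρτ]
  refine ⟨{
    p := p
    q := q.compl₂ τ
    p_smul := p_smul
    p_op_smul := p_op_smul
    q_smul := fun b j i => q_smul b j (τ i)
    q_op_smul := fun b j i => ?_
    p_balanced := p_bal
    q_balanced := fun a j i => ?_
    p_assoc := p_assoc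
    q_assoc := fun j i j' => ?_
    p_unit := ⟨s, hs⟩
    q_unit := ⟨LinearMap.lTensor J τe.symm.toLinearMap t, ?_⟩ }⟩
  · rw [LinearMap.compl₂_apply, LinearMap.compl₂_apply, τ_right, q_op_smul]
  · rw [LinearMap.compl₂_apply, LinearMap.compl₂_apply, q_bal, τ_left]
  · -- Both sides agree after pairing with `I` on the left, and this pairing is faithful.
    rw [LinearMap.compl₂_apply, ← sub_eq_zero]
    have h0 : ∀ i₀, p i₀ (q j (τ i) • j' - op (p i j') • j) = 0 := fun i₀ => by
      rw [map_sub, ← p_bal, ← p_assoc, p_smul, p_op_smul, sub_self]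
    generalize q j (τ i) • j' - op (p i j') • j = x at h0
    have h1 : ∀ j₁ i₁, q j₁ i₁ • x = 0 := fun j₁ i₁ => by
      let m : I →ₗ[O] J →ₗ[O] J := lB ∘ₗ q j₁
      have := lift_eq_of_balanced (s := i₁ ⊗ₜ[O] x) (t := 0) m (fun b i j => by
        change q j₁ (op b • i) • j = q j₁ i • b • j
        rw [q_op_smul, mul_smul]) (p_inj _ _ (by rw [TensorProduct.lift.tmul, h0, map_zero]))
      rwa [map_zero] at this
    have h2 : ∀ u, TensorProduct.lift q u • x = 0 := fun u => by
      induction u using TensorProduct.induction_on with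
      | zero => simp
      | add u v hu hv => rw [map_add, add_smul, hu, hv, add_zero]
      | tmul j i => exact h1 j i
    rw [← one_smul B x, ← ht, h2]
  · rw [← ht]
    have : ∀ u, TensorProduct.lift (q.compl₂ τ) (LinearMap.lTensor J τe.symm.toLinearMap u) =
        TensorProduct.lift q u := fun u => by
      induction u using TensorProduct.induction_on with
      | zero => simp
      | add u v hu hv => rw [map_add, map_add, hu, hv, map_add]
      | tmul j i =>
        change q j (τe (τe.symm i)) = q j i
        rw [LinearEquiv.apply_symm_apply]
    exact this t

end MoritaContexts

/-! ### The Morita context of two orders with the same division algebra and index -/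

section LatticeHom

open MulOpposite
open scoped Pointwise

/-- The `D`-linear maps `V₂ → V₁` that map each radical power of the lattice `M₂` into the
corresponding one of `M₁`. -/
def LatticeHom (D : Type*) {R₁ R₂ V₁ V₂ : Type*} [Ring R₁] [Ring R₂] [DivisionRing D]
    [AddCommGroup V₁] [Module R₁ V₁] [Module D V₁] [AddCommGroup V₂] [Module R₂ V₂] [Module D V₂]
    (M₂ : Submodule R₂ V₂) (M₁ : Submodule R₁ V₁) : Type _ :=
  {f : V₂ →ₗ[D] V₁ //
    ∀ k, ∀ w ∈ Ring.jacobson R₂ ^ k • M₂, f w ∈ Ring.jacobson R₁ ^ k • M₁}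

variable {O D R₁ R₂ V₁ V₂ : Type*} [CommRing O] [Ring R₁] [Algebra O R₁] [Ring R₂] [Algebra O R₂]
  [DivisionRing D] [Algebra O D]
  [AddCommGroup V₁] [Module O V₁] [Module R₁ V₁] [Module D V₁]
  [AddCommGroup V₂] [Module O V₂] [Module R₂ V₂] [Module D V₂]
  {M₁ : Submodule R₁ V₁} {M₂ : Submodule R₂ V₂}

namespace LatticeHom

instance : FunLike (LatticeHom D M₂ M₁) V₂ V₁ where
  coe f := f.1
  coe_injective _ _ h := Subtype.ext (DFunLike.coe_injective h)

@[ext]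
theorem ext {f g : LatticeHom D M₂ M₁} (h : ∀ w, f w = g w) : f = g := DFunLike.ext _ _ h

theorem apply_mem (f : LatticeHom D M₂ M₁) {k : ℕ} {w : V₂}
    (hw : w ∈ Ring.jacobson R₂ ^ k • M₂) : f w ∈ Ring.jacobson R₁ ^ k • M₁ := f.2 k w hw

instance : AddMonoidHomClass (LatticeHom D M₂ M₁) V₂ V₁ where
  map_add f := map_add f.1
  map_zero f := map_zero f.1

theorem map_smul (f : LatticeHom D M₂ M₁) (d : D) (w : V₂) : f (d • w) = d • f w :=
  f.1.map_smul d w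

instance : AddCommGroup (LatticeHom D M₂ M₁) :=
  inferInstanceAs (AddCommGroup (AddSubgroup.mk (AddSubmonoid.mk (AddSubsemigroup.mk
    {f : V₂ →ₗ[D] V₁ | ∀ k, ∀ w ∈ Ring.jacobson R₂ ^ k • M₂, f w ∈ Ring.jacobson R₁ ^ k • M₁}
    fun hf hg k w hw => add_mem (hf k w hw) (hg k w hw)) fun _ _ _ => zero_mem _)
    fun hf k w hw => neg_mem (hf k w hw)))

@[simp]
theorem add_apply (f g : LatticeHom D M₂ M₁) (w : V₂) : (f + g) w = f w + g w := rfl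

section Left

variable [SMulCommClass D R₁ V₁]

instance : Module R₁ (LatticeHom D M₂ M₁) where
  smul a f := ⟨a • f.1, fun k w hw => Submodule.smul_mem _ a (f.2 k w hw)⟩
  one_smul f := ext fun w => one_smul R₁ (f w)
  mul_smul a b f := ext fun w => mul_smul a b (f w)
  smul_zero a := ext fun _ => smul_zero a
  smul_add a f g := ext fun w => smul_add a (f w) (g w)
  add_smul a b f := ext fun w => add_smul a b (f w)
  zero_smul f := ext fun w => zero_smul R₁ (f w)

@[simp]
theorem smul_apply (a : R₁) (f : LatticeHom D M₂ M₁) (w : V₂) : (a • f) w = a • f w := rfl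

/-- `O` acts on `LatticeHom D M₂ M₁` through `R₁`. -/
instance : Module O (LatticeHom D M₂ M₁) := Module.compHom _ (algebraMap O R₁)

end Left

section Right

variable [SMulCommClass D R₂ V₂]

instance : Module R₂ᵐᵒᵖ (LatticeHom D M₂ M₁) where
  smul b f := ⟨
    { toFun := fun w => f (unop b • w)
      map_add' := fun v w => by rw [smul_add, map_add]
      map_smul' := fun d w => by rw [← smul_comm d, map_smul, RingHom.id_apply] },
    fun k w hw => f.2 k _ (Submodule.smul_mem _ _ hw)⟩
  one_smul f := ext fun w => congrArg f (one_smul R₂ w)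
  mul_smul a b f := ext fun w => congrArg f (mul_smul (unop b) (unop a) w)
  smul_zero a := ext fun _ => rfl
  smul_add a f g := ext fun w => rfl
  add_smul a b f := ext fun w => by
    change f ((unop a + unop b) • w) = f (unop a • w) + f (unop b • w)
    rw [add_smul, map_add]
  zero_smul f := ext fun w => by
    change f ((0 : R₂) • w) = 0
    rw [zero_smul, map_zero]

@[simp]
theorem op_smul_apply (b : R₂) (f : LatticeHom D M₂ M₁) (w : V₂) : (op b • f) w = f (b • w) := rfl

end Right

end LatticeHom

theorem LatticeHom.exists_comp_eq_smul {O D R₁ R₂ V₁ V₂ : Type*} [CommRing O] [IsDomain O]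
    [IsDiscreteValuationRing O] [HenselianLocalRing O] [Ring R₁] [Algebra O R₁] [Module.Finite O R₁]
    [Ring R₂] [DivisionRing D] [Algebra O D] [FaithfulSMul O D] [AddCommGroup V₁] [Module O V₁]
    [Module R₁ V₁] [Module D V₁] [IsScalarTower O R₁ V₁] [IsScalarTower O D V₁]
    [SMulCommClass D R₁ V₁] [AddCommGroup V₂] [Module R₂ V₂] [Module D V₂] {M₁ : Submodule R₁ V₁}
    {M₂ : Submodule R₂ V₂} (h₁ : IsLatticeModule O R₁ D V₁)
    {ϖ : O} (hϖ : Irreducible ϖ) (hM₁ : M₁.FG) (hne₁ : M₁ ≠ ⊥) (f : LatticeHom D M₂ M₁)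
    (g : LatticeHom D M₁ M₂) : ∃ r : R₁, ∀ w, f (g w) = r • w :=
  h₁.exists_eq_smul hϖ hM₁ hne₁ (f.1 ∘ₗ g.1) fun _ _ hx => f.apply_mem (g.apply_mem hx)

variable [IsScalarTower O R₁ V₁] [IsScalarTower O D V₁] [SMulCommClass D R₁ V₁]
  [SMulCommClass D R₂ V₂] [FaithfulSMul O D] [IsDomain O] [IsDiscreteValuationRing O]
  [HenselianLocalRing O]

theorem IsLatticeModule.eq_of_smul_eq {O R D V : Type*} [CommRing O] [Ring R] [DivisionRing D]
    [AddCommGroup V] [Module O V] [Module R V] [Module D V] (h : IsLatticeModule O R D V) {r s : R}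
    (hrs : ∀ w : V, r • w = s • w) : r = s := by
  obtain ⟨n, j, hj⟩ := h.exists_embedding
  rw [← mul_one r, ← mul_one s]
  refine hj ?_
  rw [← smul_eq_mul, ← smul_eq_mul, _root_.map_smul, _root_.map_smul]
  exact funext fun i => hrs _

variable [IsScalarTower O R₂ V₂] [IsScalarTower O D V₂]

/-- The lattices of two orders with the same division algebra and the same index are permuted in
the same way by the elements of `D`. -/
theorem IsLatticeModule.smul_le_iff_of_isIndex [Module.Finite O R₁] [Module.Finite O R₂]
    (h₁ : IsLatticeModule O R₁ D V₁) (h₂ : IsLatticeModule O R₂ D V₂) {ϖ : O} (hϖ : Irreducible ϖ)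
    (hM₁ : M₁.FG) (hne₁ : M₁ ≠ ⊥) (hM₂ : M₂.FG) (hne₂ : M₂ ≠ ⊥) {e : ℕ} (he₁ : IsIndex R₁ ϖ e)
    (he₂ : IsIndex R₂ ϖ e) (d : D) (i j : ℕ) :
    d • Ring.jacobson R₁ ^ i • M₁ ≤ Ring.jacobson R₁ ^ j • M₁ ↔
      d • Ring.jacobson R₂ ^ i • M₂ ≤ Ring.jacobson R₂ ^ j • M₂ := by
  rcases eq_or_ne d 0 with rfl | hd
  · simp
  · rw [h₁.smul_jacobson_pow_smul_le_iff hϖ hM₁ hne₁ he₁ hd,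
      h₂.smul_jacobson_pow_smul_le_iff hϖ hM₂ hne₂ he₂ hd]

/-- Composition, as a pairing with values in `R₁`. -/
theorem LatticeHom.exists_pairing [Module.Finite O R₁] (h₁ : IsLatticeModule O R₁ D V₁)
    {ϖ : O} (hϖ : Irreducible ϖ) (hM₁ : M₁.FG) (hne₁ : M₁ ≠ ⊥) :
    ∃ p : LatticeHom D M₂ M₁ →ₗ[O] LatticeHom D M₁ M₂ →ₗ[O] R₁, ∀ f g w, p f g • w = f (g w) := by
  choose c hc using LatticeHom.exists_comp_eq_smul (M₂ := M₂) h₁ hϖ hM₁ hne₁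
  refine ⟨LinearMap.mk₂ O c (fun f f' g => ?_) (fun r f g => ?_) (fun f g g' => ?_)
    (fun r f g => ?_), fun f g w => (hc f g w).symm⟩ <;> refine h₁.eq_of_smul_eq fun w => ?_
  · rw [add_smul, ← hc, ← hc, ← hc, LatticeHom.add_apply]
  · rw [← hc, smul_assoc, ← hc, ← algebraMap_smul R₁ r (f (g w))]
    rfl
  · rw [add_smul, ← hc, ← hc, ← hc, LatticeHom.add_apply, map_add]
  · rw [← hc, smul_assoc, ← hc]
    change f (algebraMap O R₂ r • g w) = _
    rw [algebraMap_smul, ← algebraMap_smul D r (g w), LatticeHom.map_smul, algebraMap_smul]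

/-- The composition pairing represents `1`. It represents each value `φ x` of a homomorphism from a
lattice to `R₁`: this endomorphism `w ↦ f w • x` factors through `V₂`, since a dual basis of the
corresponding lattice in `V₂` gives `1 = ∑ g y` with lattice elements `y` and forms `g`. -/
theorem LatticeHom.exists_lift_eq_one [Module.Finite O R₁] [Module.Finite O R₂]
    (h₁ : IsLatticeModule O R₁ D V₁) (h₂ : IsLatticeModule O R₂ D V₂) {ϖ : O} (hϖ : Irreducible ϖ)
    (hM₁ : M₁.FG) (hne₁ : M₁ ≠ ⊥) (hM₂ : M₂.FG) (hne₂ : M₂ ≠ ⊥) {e : ℕ} (he₁ : IsIndex R₁ ϖ e)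
    (he₂ : IsIndex R₂ ϖ e)
    (p : LatticeHom D M₂ M₁ →ₗ[O] LatticeHom D M₁ M₂ →ₗ[O] R₁)
    (hp : ∀ f g w, p f g • w = f (g w)) : ∃ t, TensorProduct.lift p t = 1 := by
  have := isNoetherianRing_of_finite_algebra O R₂
  suffices key : ∀ r : R₁, ∃ t, TensorProduct.lift p t = r from key 1
  intro r
  have hr : r ∈ AddSubmonoid.closure (latticeValues M₁ R₁) :=
    h₁.closure_latticeValues hϖ hM₁ hne₁ ▸ trivial
  induction hr using AddSubmonoid.closure_induction with
  | zero => exact ⟨0, map_zero _⟩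
  | add r s _ _ hr hs =>
    obtain ⟨t, rfl⟩ := hr
    obtain ⟨t', rfl⟩ := hs
    exact ⟨t + t', map_add _ _ _⟩
  | mem r hr =>
    obtain ⟨k, φ, x, rfl⟩ := hr
    obtain ⟨l, hl⟩ := h₁.exists_linearMap (h₁.jacobson_pow_smul_ne_bot hϖ hM₁ hne₁ k) φ
    obtain ⟨s, m, hm, hsum⟩ := h₂.exists_sum_eq_one (fg_ideal_smul (Ring.jacobson R₂ ^ k) hM₂)
      (h₂.jacobson_pow_smul_ne_bot hϖ hM₂ hne₂ k)
    have halign := h₁.smul_le_iff_of_isIndex h₂ hϖ hM₁ hne₁ hM₂ hne₂ he₁ he₂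
    let F : (Ring.jacobson R₂ ^ k • M₂ : Submodule R₂ V₂) → LatticeHom D M₂ M₁ := fun y =>
      ⟨(m y).smulRight (x : V₁), fun j w hw => by
        refine (halign (m y w) k j).2 ?_ (Submodule.smul_mem_pointwise_smul _ _ _ x.2)
        rintro _ ⟨v, hv, rfl⟩
        obtain ⟨r, hr⟩ := hm y v hv
        change m y w • v ∈ _
        rw [hr]
        exact Submodule.smul_mem _ _ hw⟩
    let G : (Ring.jacobson R₂ ^ k • M₂ : Submodule R₂ V₂) → LatticeHom D M₁ M₂ := fun y =>
      ⟨l.smulRight (y : V₂), fun j w hw => by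
        refine (halign (l w) k j).1 ?_ (Submodule.smul_mem_pointwise_smul _ _ _ y.2)
        rintro _ ⟨v, hv, rfl⟩
        change l w • v ∈ _
        rw [← hl ⟨v, hv⟩ w]
        exact Submodule.smul_mem _ _ hw⟩
    refine ⟨∑ y ∈ s, F y ⊗ₜ[O] G y, h₁.eq_of_smul_eq fun w => ?_⟩
    rw [map_sum, Finset.sum_smul, hl]
    calc ∑ y ∈ s, TensorProduct.lift p (F y ⊗ₜ[O] G y) • w
        = ∑ y ∈ s, l w • m y y • (x : V₁) := Finset.sum_congr rfl fun y _ => by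
          rw [TensorProduct.lift.tmul, hp]
          change m y (l w • (y : V₂)) • (x : V₁) = _
          rw [_root_.map_smul, smul_eq_mul, mul_smul]
      _ = l w • (x : V₁) := by rw [← Finset.smul_sum, ← Finset.sum_smul, hsum, one_smul]

/-- Two orders with the same division algebra and the same index are Morita equivalent. -/
theorem IsLatticeModule.moritaEquivalent {O : Type*} {R₁ R₂ V₁ V₂ : Type w} {D : Type*}
    [CommRing O] [Ring R₁] [Algebra O R₁] [Ring R₂] [Algebra O R₂] [DivisionRing D] [Algebra O D]
    [AddCommGroup V₁] [Module O V₁] [Module R₁ V₁] [Module D V₁] [IsScalarTower O R₁ V₁]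
    [IsScalarTower O D V₁] [SMulCommClass D R₁ V₁]
    [AddCommGroup V₂] [Module O V₂] [Module R₂ V₂] [Module D V₂] [IsScalarTower O R₂ V₂]
    [IsScalarTower O D V₂] [SMulCommClass D R₂ V₂] [FaithfulSMul O D] [IsDomain O]
    [IsDiscreteValuationRing O] [HenselianLocalRing O] [Module.Finite O R₁] [Module.Finite O R₂]
    [Nontrivial V₁] [Nontrivial V₂]
    (h₁ : IsLatticeModule O R₁ D V₁) (h₂ : IsLatticeModule O R₂ D V₂) {ϖ : O} (hϖ : Irreducible ϖ)
    {e : ℕ} (he₁ : IsIndex R₁ ϖ e) (he₂ : IsIndex R₂ ϖ e) : MoritaEquivalent O R₁ R₂ := by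
  obtain ⟨v₁, hv₁⟩ := exists_ne (0 : V₁)
  obtain ⟨v₂, hv₂⟩ := exists_ne (0 : V₂)
  let M₁ := Submodule.span R₁ {v₁}
  let M₂ := Submodule.span R₂ {v₂}
  have hM₁ : M₁.FG := Submodule.fg_span_singleton v₁
  have hM₂ : M₂.FG := Submodule.fg_span_singleton v₂
  have hne₁ : M₁ ≠ ⊥ := by simpa [M₁] using hv₁
  have hne₂ : M₂ ≠ ⊥ := by simpa [M₂] using hv₂
  obtain ⟨p, hp⟩ := LatticeHom.exists_pairing (M₂ := M₂) h₁ hϖ hM₁ hne₁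
  obtain ⟨q, hq⟩ := LatticeHom.exists_pairing (M₂ := M₁) h₂ hϖ hM₂ hne₂
  let c : MoritaContext O R₁ R₂ (LatticeHom D M₂ M₁) (LatticeHom D M₁ M₂) :=
    { p := p
      q := q
      p_smul := fun a f g => h₁.eq_of_smul_eq fun w => by
        rw [mul_smul, hp, hp, LatticeHom.smul_apply]
      p_op_smul := fun a f g => h₁.eq_of_smul_eq fun w => by
        rw [mul_smul, hp, hp, LatticeHom.op_smul_apply]
      q_smul := fun a f g => h₂.eq_of_smul_eq fun w => by
        rw [mul_smul, hq, hq, LatticeHom.smul_apply]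
      q_op_smul := fun a f g => h₂.eq_of_smul_eq fun w => by
        rw [mul_smul, hq, hq, LatticeHom.op_smul_apply]
      p_balanced := fun b f g => h₁.eq_of_smul_eq fun w => by
        rw [hp, hp, LatticeHom.op_smul_apply, LatticeHom.smul_apply]
      q_balanced := fun b f g => h₂.eq_of_smul_eq fun w => by
        rw [hq, hq, LatticeHom.op_smul_apply, LatticeHom.smul_apply]
      p_assoc := fun f g f' => LatticeHom.ext fun w => by
        rw [LatticeHom.op_smul_apply, LatticeHom.smul_apply, hp, hq]
      q_assoc := fun g f g' => LatticeHom.ext fun w => by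
        rw [LatticeHom.op_smul_apply, LatticeHom.smul_apply, hp, hq]
      p_unit := LatticeHom.exists_lift_eq_one h₁ h₂ hϖ hM₁ hne₁ hM₂ hne₂ he₁ he₂ p hp
      q_unit := LatticeHom.exists_lift_eq_one h₂ h₁ hϖ hM₂ hne₂ hM₁ hne₁ he₂ he₁ q hq }
  have hI : IsBimodule O R₁ R₂ (LatticeHom D M₂ M₁) :=
    { left_compat := ⟨fun r a f => LatticeHom.ext fun w => by
        change (r • a) • f w = algebraMap O R₁ r • a • f w
        rw [smul_assoc, algebraMap_smul]⟩
      right_compat := ⟨fun r b f => LatticeHom.ext fun w => by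
        change f ((r • unop b) • w) = algebraMap O R₁ r • f (unop b • w)
        rw [smul_assoc, algebraMap_smul, ← algebraMap_smul D r, LatticeHom.map_smul,
          algebraMap_smul]⟩
      comm := ⟨fun a b f => rfl⟩ }
  have hJ : IsBimodule O R₂ R₁ (LatticeHom D M₁ M₂) :=
    { left_compat := ⟨fun r a f => LatticeHom.ext fun w => by
        change (r • a) • f w = algebraMap O R₂ r • a • f w
        rw [smul_assoc, algebraMap_smul]⟩
      right_compat := ⟨fun r b f => LatticeHom.ext fun w => by
        change f ((r • unop b) • w) = algebraMap O R₂ r • f (unop b • w)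
        rw [smul_assoc, algebraMap_smul, ← algebraMap_smul D r, LatticeHom.map_smul,
          algebraMap_smul]⟩
      comm := ⟨fun a b f => rfl⟩ }
  exact ⟨LatticeHom D M₂ M₁, LatticeHom D M₁ M₂, inferInstance, inferInstance, inferInstance,
    inferInstance, inferInstance, inferInstance, inferInstance, inferInstance, hI, hJ,
    c.hasBimoduleIso hI, c.symm.hasBimoduleIso hJ⟩

end LatticeHom

/-! ### Morita invariance of the index -/

section IndexTransport

open MulOpposite

/-- A two-sided ideal with a power in the Jacobson radical is contained in it. -/
theorem le_jacobson_of_pow_le {A : Type*} [Ring A] {I : Ideal A} [I.IsTwoSided] {n : ℕ}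
    (h : I ^ n ≤ Ring.jacobson A) : I ≤ Ring.jacobson A := by
  rw [Ring.jacobson_eq_sInf_isMaximal]
  refine le_sInf fun m hm => ?_
  have hm' : m.IsMaximal := hm
  by_contra hI
  have hsup : I ⊔ m = ⊤ := by
    by_contra hne
    have := hm'.eq_of_le hne le_sup_right
    exact hI (this ▸ le_sup_left)
  have key : ∀ k : ℕ, I ^ k ⊔ m = ⊤ := fun k => by
    induction k with
    | zero => rw [Submodule.pow_zero, Ideal.one_eq_top, top_sup_eq]
    | succ k ih =>
      refine eq_top_iff.2 (ih.symm.le.trans (sup_le ?_ le_sup_right))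
      intro x hx
      obtain ⟨y, hy, z, hz, hyz⟩ :=
        Submodule.mem_sup.1 (hsup.symm ▸ Submodule.mem_top : (1 : A) ∈ I ⊔ m)
      rw [← mul_one x, ← hyz, mul_add, Submodule.pow_succ]
      exact add_mem (Submodule.mem_sup_left (Ideal.mul_mem_mul hx hy))
        (Submodule.mem_sup_right (m.mul_mem_left x hz))
  have := key n
  rw [sup_eq_right.2 (h.trans (Ring.jacobson_le_of_isMaximal m))] at this
  exact hm'.ne_top this

variable {O A B I J : Type*} [CommRing O] [Ring A] [Algebra O A] [Ring B]
    [Algebra O B] [AddCommGroup I] [Module O I] [Module A I] [Module Bᵐᵒᵖ I]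
    [AddCommGroup J] [Module O J] [Module B J] [Module Aᵐᵒᵖ J]

namespace MoritaContext

theorem one_mem_of_q_mem (c : MoritaContext O A B I J) {S : AddSubmonoid B}
    (hS : ∀ j i, c.q j i ∈ S) : 1 ∈ S := by
  obtain ⟨t, ht⟩ := c.q_unit
  rw [← ht]
  clear ht
  induction t using TensorProduct.induction_on with
  | zero => rw [map_zero]; exact zero_mem _
  | add s t hs ht => rw [map_add]; exact add_mem hs ht
  | tmul j i => exact hS j i

/-- The ideal `J 𝔞 I` of `B` that corresponds to the two-sided ideal `𝔞` of `A`. -/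
def mapIdeal (c : MoritaContext O A B I J) (𝔞 : Ideal A) : Ideal B :=
  Submodule.span B {b | ∃ j, ∃ a ∈ 𝔞, ∃ i, c.q j (a • i) = b}

theorem mem_mapIdeal (c : MoritaContext O A B I J) {𝔞 : Ideal A} (j : J) {a : A} (ha : a ∈ 𝔞)
    (i : I) : c.q j (a • i) ∈ c.mapIdeal 𝔞 :=
  Submodule.subset_span ⟨j, a, ha, i, rfl⟩

theorem mapIdeal_le_iff (c : MoritaContext O A B I J) {𝔞 : Ideal A} {𝔟 : Ideal B} :
    c.mapIdeal 𝔞 ≤ 𝔟 ↔ ∀ j, ∀ a ∈ 𝔞, ∀ i, c.q j (a • i) ∈ 𝔟 := by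
  refine Submodule.span_le.trans ⟨fun h j a ha i => h ⟨j, a, ha, i, rfl⟩, ?_⟩
  rintro h _ ⟨j, a, ha, i, rfl⟩
  exact h j a ha i

theorem mapIdeal_mono (c : MoritaContext O A B I J) {𝔞 𝔟 : Ideal A} (h : 𝔞 ≤ 𝔟) :
    c.mapIdeal 𝔞 ≤ c.mapIdeal 𝔟 :=
  c.mapIdeal_le_iff.2 fun j _ ha i => c.mem_mapIdeal j (h ha) i

instance isTwoSided_mapIdeal [SMulCommClass A Bᵐᵒᵖ I] (c : MoritaContext O A B I J) (𝔞 : Ideal A) :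
    (c.mapIdeal 𝔞).IsTwoSided := by
  refine ⟨fun {x} b hx => ?_⟩
  induction hx using Submodule.span_induction with
  | mem x hx =>
    obtain ⟨j, a, ha, i, rfl⟩ := hx
    rw [← c.q_op_smul, ← smul_comm a (op b) i]
    exact c.mem_mapIdeal j ha _
  | zero => rw [zero_mul]; exact zero_mem _
  | add x y _ _ hx hy => rw [add_mul]; exact add_mem hx hy
  | smul r x _ hx => rw [smul_eq_mul, mul_assoc]; exact Ideal.mul_mem_left _ _ hx

theorem mapIdeal_mul [SMulCommClass A Bᵐᵒᵖ I] (c : MoritaContext O A B I J) (𝔞 𝔟 : Ideal A)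
    [𝔞.IsTwoSided] : c.mapIdeal (𝔞 * 𝔟) = c.mapIdeal 𝔞 * c.mapIdeal 𝔟 := by
  refine le_antisymm (c.mapIdeal_le_iff.2 fun j x hx i => ?_) (Ideal.mul_le.2 fun x hx y hy => ?_)
  · refine Submodule.smul_induction_on (p := fun x => c.q j (x • i) ∈ c.mapIdeal 𝔞 * c.mapIdeal 𝔟)
      hx (fun a ha b hb => ?_) fun x y hx hy => by rw [add_smul, map_add]; exact add_mem hx hy
    have := c.symm.one_mem_of_q_mem (S := (c.mapIdeal 𝔞 * c.mapIdeal 𝔟).toAddSubmonoid.comap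
        ((c.q j).toAddMonoidHom.comp ((DistribSMul.toAddMonoidHom I a).comp
          ((smulAddHom A I).flip (b • i))))) fun i' j' => by
      change c.q j (a • c.p i' j' • b • i) ∈ c.mapIdeal 𝔞 * c.mapIdeal 𝔟
      rw [c.p_assoc, smul_comm a, c.q_op_smul]
      exact Ideal.mul_mem_mul (c.mem_mapIdeal j ha i') (c.mem_mapIdeal j' hb i)
    change c.q j (a • (1 : A) • b • i) ∈ c.mapIdeal 𝔞 * c.mapIdeal 𝔟 at this
    rwa [one_smul, ← mul_smul] at this
  · induction hx using Submodule.span_induction with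
    | mem x hx =>
      obtain ⟨j, a, ha, i, rfl⟩ := hx
      induction hy using Submodule.span_induction generalizing i with
      | mem y hy =>
        obtain ⟨j', b, hb, i', rfl⟩ := hy
        rw [← c.q_op_smul, ← smul_comm a, ← c.p_assoc, ← mul_smul, ← mul_smul]
        exact c.mem_mapIdeal _ (Ideal.mul_mem_mul (Ideal.mul_mem_right _ _ ha) hb) _
      | zero => rw [mul_zero]; exact zero_mem _
      | add x y _ _ hx hy => rw [mul_add]; exact add_mem (hx i) (hy i)
      | smul r y _ hy =>
        rw [smul_eq_mul, ← mul_assoc, ← c.q_op_smul, ← smul_comm a]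
        exact hy _
    | zero => rw [zero_mul]; exact zero_mem _
    | add x y _ _ hx hy => rw [add_mul]; exact add_mem hx hy
    | smul r x _ hx => rw [smul_eq_mul, mul_assoc]; exact Ideal.mul_mem_left _ _ hx

/-- The ideal correspondences of a Morita context and of its opposite are inverse. -/
theorem mapIdeal_mapIdeal [SMulCommClass A Bᵐᵒᵖ I] (c : MoritaContext O A B I J) (𝔞 : Ideal A)
    [𝔞.IsTwoSided] : c.symm.mapIdeal (c.mapIdeal 𝔞) = 𝔞 := by
  refine le_antisymm (c.symm.mapIdeal_le_iff.2 fun i b hb j => ?_) fun a ha => ?_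
  · change c.p i (b • j) ∈ 𝔞
    induction hb using Submodule.span_induction generalizing i with
    | mem b hb =>
      obtain ⟨j', a, ha, i', rfl⟩ := hb
      rw [c.q_assoc, c.p_op_smul, c.p_smul]
      exact Ideal.mul_mem_left _ _ (Ideal.mul_mem_right _ _ ha)
    | zero => rw [zero_smul, map_zero]; exact zero_mem _
    | add x y _ _ hx hy => rw [add_smul, map_add]; exact add_mem (hx i) (hy i)
    | smul r x _ hx => rw [smul_eq_mul, mul_smul, ← c.p_balanced]; exact hx _
  · have key : ∀ i j i' j', c.p i j * a * c.p i' j' ∈ c.symm.mapIdeal (c.mapIdeal 𝔞) := by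
      intro i j i' j'
      rw [mul_assoc, ← c.p_smul, ← c.p_op_smul, ← c.q_assoc]
      exact c.symm.mem_mapIdeal i (c.mem_mapIdeal j ha i') j'
    have key' : ∀ i j, c.p i j * a ∈ c.symm.mapIdeal (c.mapIdeal 𝔞) := fun i j => by
      have := c.symm.one_mem_of_q_mem (S := (c.symm.mapIdeal (c.mapIdeal 𝔞)).toAddSubmonoid.comap
        (AddMonoidHom.mulLeft (c.p i j * a))) fun i' j' => key i j i' j'
      simpa using this
    have := c.symm.one_mem_of_q_mem (S := (c.symm.mapIdeal (c.mapIdeal 𝔞)).toAddSubmonoid.comap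
        (AddMonoidHom.mulRight a)) fun i j => key' i j
    simpa using this

theorem mapIdeal_top [SMulCommClass A Bᵐᵒᵖ I] (c : MoritaContext O A B I J) :
    c.mapIdeal ⊤ = ⊤ := by
  refine (Ideal.eq_top_iff_one _).2
    (c.one_mem_of_q_mem (S := (c.mapIdeal ⊤).toAddSubmonoid) fun j i => ?_)
  simpa using c.mem_mapIdeal j (Submodule.mem_top (x := (1 : A))) i

theorem mapIdeal_pow [SMulCommClass A Bᵐᵒᵖ I] (c : MoritaContext O A B I J) (𝔞 : Ideal A)
    [𝔞.IsTwoSided] (n : ℕ) : c.mapIdeal (𝔞 ^ n) = c.mapIdeal 𝔞 ^ n := by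
  induction n with
  | zero => rw [Submodule.pow_zero, Submodule.pow_zero, Ideal.one_eq_top, c.mapIdeal_top,
      Ideal.one_eq_top]
  | succ n ih => rw [Submodule.pow_succ, Submodule.pow_succ, c.mapIdeal_mul, ih]

theorem mapIdeal_span_algebraMap [IsScalarTower O A I] (c : MoritaContext O A B I J) (r : O) :
    c.mapIdeal (Ideal.span {algebraMap O A r}) = Ideal.span {algebraMap O B r} := by
  refine le_antisymm (c.mapIdeal_le_iff.2 fun j x hx i => ?_) ?_
  · obtain ⟨s, rfl⟩ := Ideal.mem_span_singleton'.1 hx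
    rw [← Algebra.commutes, mul_smul, algebraMap_smul, map_smul, Algebra.smul_def, Algebra.commutes]
    exact Ideal.mul_mem_left _ _ (Ideal.mem_span_singleton_self _)
  · rw [Ideal.span_singleton_le_iff_mem]
    have := c.one_mem_of_q_mem
        (S := (c.mapIdeal (Ideal.span {algebraMap O A r})).toAddSubmonoid.comap
          (AddMonoidHom.mulRight (algebraMap O B r))) fun j i => by
      change c.q j i * algebraMap O B r ∈ c.mapIdeal (Ideal.span {algebraMap O A r})
      rw [← Algebra.commutes, ← Algebra.smul_def, ← map_smul, ← algebraMap_smul A r i]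
      exact c.mem_mapIdeal j (Ideal.mem_span_singleton_self _) i
    simpa using this

theorem mapIdeal_jacobson_le [SMulCommClass A Bᵐᵒᵖ I] [IsScalarTower O A I]
    (c : MoritaContext O A B I J) {ϖ : O} {e e' : ℕ} (h : IsIndex A ϖ e) (h' : IsIndex B ϖ e') :
    c.mapIdeal (Ring.jacobson A) ≤ Ring.jacobson B := by
  have : c.mapIdeal (Ring.jacobson A) ^ e ≤ Ring.jacobson B := by
    rw [← c.mapIdeal_pow, h.2, c.mapIdeal_span_algebraMap, ← h'.2]
    exact (Ideal.pow_le_pow_right h'.1).trans (Submodule.pow_one _).le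
  exact le_jacobson_of_pow_le this

/-- The index is a Morita invariant, provided that both rings have one: the radical corresponds to
the radical, being the largest two-sided ideal with a power in `ϖ A`. -/
theorem isIndex [SMulCommClass A Bᵐᵒᵖ I] [IsScalarTower O A I] [SMulCommClass B Aᵐᵒᵖ J]
    [IsScalarTower O B J] (c : MoritaContext O A B I J) {ϖ : O} {e e' : ℕ}
    (h : IsIndex A ϖ e) (h' : IsIndex B ϖ e') : IsIndex B ϖ e := by
  have hjac : c.mapIdeal (Ring.jacobson A) = Ring.jacobson B := by
    refine le_antisymm (c.mapIdeal_jacobson_le h h') ?_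
    have := c.mapIdeal_mono (c.symm.mapIdeal_jacobson_le h' h)
    rwa [show c.mapIdeal (c.symm.mapIdeal (Ring.jacobson B)) = Ring.jacobson B from
      c.symm.mapIdeal_mapIdeal _] at this
  exact ⟨h.1, by rw [← hjac, ← c.mapIdeal_pow, h.2, c.mapIdeal_span_algebraMap]⟩

end MoritaContext

end IndexTransport

/-! ### Corners of simple Artinian algebras -/

section Corner

variable {K C B : Type*} [Field K] [Ring C] [Algebra K C] [Ring B] [Algebra K B]

/-- The left ideal `C ε` for an idempotent `ε`. -/
def cornerIdeal (ε : C) : Ideal C where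
  carrier := {x | x * ε = x}
  add_mem' {x y} hx hy := by
    change (x + y) * ε = x + y
    rw [add_mul, hx, hy]
  zero_mem' := zero_mul _
  smul_mem' c x hx := by
    change c • x * ε = c • x
    rw [smul_eq_mul, mul_assoc, hx]

/-- Right multiplication identifies the opposite of the corner ring `ε C ε` with the endomorphism
ring of `C ε`. -/
theorem nonempty_algEquiv_end_cornerIdeal (ψ : B →ₗ[K] C) (hmul : ∀ x y, ψ (x * y) = ψ x * ψ y)
    (hinj : Function.Injective ψ) (hsurj : ∀ c, ∃ b, ψ b = ψ 1 * c * ψ 1) :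
    Nonempty (Bᵐᵒᵖ ≃ₐ[K] Module.End C (cornerIdeal (ψ 1))) := by
  have hr : ∀ b, ψ b * ψ 1 = ψ b := fun b => by rw [← hmul, mul_one]
  have hl : ∀ b, ψ 1 * ψ b = ψ b := fun b => by rw [← hmul, one_mul]
  let X := cornerIdeal (ψ 1)
  let one' : X := ⟨ψ 1, hr 1⟩
  let g : Bᵐᵒᵖ →ₗ[K] Module.End C X :=
    { toFun := fun b =>
        { toFun := fun x => ⟨x * ψ b.unop, by
            change x * ψ b.unop * ψ 1 = x * ψ b.unop
            rw [mul_assoc, hr]⟩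
          map_add' := fun x y => Subtype.ext (add_mul _ _ _)
          map_smul' := fun c x => Subtype.ext (mul_assoc _ _ _) }
      map_add' := fun b b' => LinearMap.ext fun x => Subtype.ext <| by
        change (x : C) * ψ (b.unop + b'.unop) = x * ψ b.unop + x * ψ b'.unop
        rw [map_add, mul_add]
      map_smul' := fun k b => LinearMap.ext fun x => Subtype.ext <| by
        change (x : C) * ψ (k • b.unop) = k • (x * ψ b.unop)
        rw [map_smul, mul_smul_comm] }
  have hg : ∀ b x, ((g b x : X) : C) = x * ψ b.unop := fun _ _ => rfl
  refine ⟨AlgEquiv.ofBijective (AlgHom.ofLinearMap g ?_ ?_) ⟨fun b b' h => ?_, fun f => ?_⟩⟩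
  · exact LinearMap.ext fun x => Subtype.ext x.2
  · exact fun b b' => LinearMap.ext fun x => Subtype.ext <| by
      rw [Module.End.mul_apply, hg, hg, hg, MulOpposite.unop_mul, hmul, mul_assoc]
  · refine MulOpposite.unop_injective (hinj ?_)
    have : ((g b one' : X) : C) = g b' one' :=
      congrArg (fun f : Module.End C X => ((f one' : X) : C)) h
    rwa [hg, hg, show (one' : C) = ψ 1 from rfl, hl, hl] at this
  · obtain ⟨b, hb⟩ := hsurj (f one' : X)
    refine ⟨MulOpposite.op b, LinearMap.ext fun x => Subtype.ext ?_⟩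
    change (x : C) * ψ b = f x
    have hx : x = (x : C) • one' := Subtype.ext x.2.symm
    have h2 : ((f one' : X) : C) * ψ 1 = f one' := (f one').2
    conv_rhs => rw [hx, map_smul]
    rw [hb, mul_assoc, h2, ← mul_assoc, show (x : C) * ψ 1 = x from x.2]
    rfl

/-- A corner of a simple Artinian algebra `C` and `C` itself are matrix algebras over the same
algebra. -/
theorem exists_matrix_algEquiv_of_corner [Nontrivial B] [IsSimpleRing C] [IsArtinianRing C]
    (ψ : B →ₗ[K] C) (hmul : ∀ x y, ψ (x * y) = ψ x * ψ y)
    (hinj : Function.Injective ψ) (hsurj : ∀ c, ∃ b, ψ b = ψ 1 * c * ψ 1) :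
    ∃ r t : ℕ, r ≠ 0 ∧ t ≠ 0 ∧ ∃ S : Ideal C,
      Nonempty (B ≃ₐ[K] Matrix (Fin r) (Fin r) (Module.End C S)ᵐᵒᵖ) ∧
      Nonempty (C ≃ₐ[K] Matrix (Fin t) (Fin t) (Module.End C S)ᵐᵒᵖ) := by
  obtain ⟨e⟩ := nonempty_algEquiv_end_cornerIdeal ψ hmul hinj hsurj
  obtain ⟨t, ht, S, hS, ⟨u⟩⟩ := (IsSimpleRing.isIsotypic C C).linearEquiv_fun
  have hiso : IsIsotypicOfType C (cornerIdeal (ψ 1)) S :=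
    (IsSimpleRing.isIsotypic C C S).of_injective (Submodule.subtype _) Subtype.val_injective
  obtain ⟨r, ⟨v⟩⟩ := hiso.linearEquiv_fun
  refine ⟨r, t, ?_, ht.out, S,
    ⟨.trans (.opOp K B) <| .trans (.op <| .trans e <| .trans (v.conjAlgEquiv K)
      (endVecAlgEquivMatrixEnd ..)) (.symm .mopMatrix)⟩,
    ⟨.trans (.opOp K C) <| .trans (.op <| .trans (.moduleEndSelf K) <| .trans (u.conjAlgEquiv K)
      (endVecAlgEquivMatrixEnd ..)) (.symm .mopMatrix)⟩⟩
  rintro rfl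
  have := v.toEquiv.subsingleton
  have := e.toEquiv.subsingleton
  exact not_subsingleton B (MulOpposite.opEquiv (α := B)).subsingleton

open Matrix in
/-- Central simple algebras are Brauer equivalent if one is a corner of a matrix algebra over the
other. -/
theorem isBrauerEquivalent_of_corner {K : Type*} [Field K] {A₁ A₂ : CSA K} {n : ℕ} (hn : n ≠ 0)
    (ψ : A₂ →ₗ[K] Matrix (Fin n) (Fin n) A₁) (hmul : ∀ x y, ψ (x * y) = ψ x * ψ y)
    (hinj : Function.Injective ψ) (hsurj : ∀ c, ∃ b, ψ b = ψ 1 * c * ψ 1) :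
    IsBrauerEquivalent A₁ A₂ := by
  have : NeZero n := ⟨hn⟩
  have : IsArtinianRing A₁ := IsArtinianRing.of_finite K A₁
  have : IsArtinianRing (Matrix (Fin n) (Fin n) A₁) := IsArtinianRing.of_finite K _
  obtain ⟨r, t, hr, ht, S, ⟨f⟩, ⟨g⟩⟩ := exists_matrix_algEquiv_of_corner ψ hmul hinj hsurj
  exact ⟨r * n, t, mul_ne_zero hr hn, ht,
    ⟨reindexAlgEquiv _ _ finProdFinEquiv |>.symm.trans <| compAlgEquiv _ _ _ _|>.symm.trans <|
    g.mapMatrix (m := Fin r)|>.trans <| compAlgEquiv _ _ _ _|>.trans <|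
    reindexAlgEquiv K _ (.prodComm (Fin r) (Fin t))|>.trans <| compAlgEquiv _ _ _ _|>.symm.trans <|
    f.symm.mapMatrix⟩⟩

end Corner

/-! ### Morita equivalent orders span Brauer equivalent algebras -/

section Denominators

section Tower

variable {O : Type*} (K : Type*) [CommRing O] [Field K] [Algebra O K] [FaithfulSMul O K]

theorem smul_eq_zero_of_tower {M : Type*} [AddCommGroup M] [Module O M] [Module K M]
    [IsScalarTower O K M] {c : O} (hc : c ≠ 0) {x : M} (h : c • x = 0) : x = 0 := by
  have hck : algebraMap O K c ≠ 0 := by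
    simpa using (FaithfulSMul.algebraMap_injective O K).ne hc
  rw [← algebraMap_smul K c] at h
  exact (smul_eq_zero.1 h).resolve_left hck

theorem isUnit_algebraMap_end [Nontrivial O] (M : Type*) [AddCommGroup M] [Module O M] [Module K M]
    [IsScalarTower O K M] (c : nonZeroDivisors O) :
    IsUnit (algebraMap O (Module.End O M) c) := by
  have hc := nonZeroDivisors.ne_zero c.2
  have hck : algebraMap O K c ≠ 0 := by
    simpa only [map_zero] using (FaithfulSMul.algebraMap_injective O K).ne hc
  refine (Module.End.isUnit_iff _).2 ⟨fun x y hxy => ?_, fun y => ⟨(algebraMap O K c)⁻¹ • y, ?_⟩⟩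
  · rw [← sub_eq_zero, ← map_sub] at hxy
    exact sub_eq_zero.1 (smul_eq_zero_of_tower K hc hxy)
  · change (c : O) • (algebraMap O K c)⁻¹ • y = y
    rw [← algebraMap_smul K (c : O), smul_smul, mul_inv_cancel₀ hck, one_smul]

end Tower

variable {O K A : Type*} [CommRing O] [IsDomain O] [Field K] [Algebra O K] [IsFractionRing O K]
  [Ring A] [Algebra O A] [Algebra K A] [IsScalarTower O K A] {𝒜 : Subalgebra O A}

theorem exists_smul_mem_of_span_eq_top (h : Submodule.span K (𝒜 : Set A) = ⊤) (a : A) :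
    ∃ c : O, c ≠ 0 ∧ c • a ∈ 𝒜 := by
  have ha : a ∈ Submodule.span K (𝒜 : Set A) := h ▸ Submodule.mem_top
  induction ha using Submodule.span_induction with
  | mem x hx => exact ⟨1, one_ne_zero, by rwa [one_smul]⟩
  | zero => exact ⟨1, one_ne_zero, by rw [smul_zero]; exact zero_mem _⟩
  | add x y _ _ hx hy =>
    obtain ⟨c, hc, hx⟩ := hx
    obtain ⟨d, hd, hy⟩ := hy
    refine ⟨c * d, mul_ne_zero hc hd, ?_⟩
    rw [smul_add]
    refine add_mem ?_ ?_
    · rw [mul_comm, mul_smul]; exact 𝒜.smul_mem hx d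
    · rw [mul_smul]; exact 𝒜.smul_mem hy c
  | smul k x _ hx =>
    obtain ⟨c, hc, hx⟩ := hx
    obtain ⟨r, d, hd, rfl⟩ := IsFractionRing.div_surjective O k
    have hd0 := nonZeroDivisors.ne_zero hd
    refine ⟨c * d, mul_ne_zero hc hd0, ?_⟩
    have hdk : algebraMap O K d ≠ 0 := by
      simpa using (FaithfulSMul.algebraMap_injective O K).ne hd0
    have : (c * d) • (algebraMap O K r / algebraMap O K d) • x = r • c • x := by
      rw [← algebraMap_smul K (c * d), smul_smul, map_mul, mul_assoc, mul_div_cancel₀ _ hdk,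
        ← map_mul, algebraMap_smul, mul_comm, mul_smul]
    rw [this]
    exact 𝒜.smul_mem hx r

/-- Linear maps from an order extend to the algebra that it spans. -/
theorem exists_linearMap_extend (h : Submodule.span K (𝒜 : Set A) = ⊤) {M : Type*}
    [AddCommGroup M] [Module O M] [Module K M] [IsScalarTower O K M] (φ : 𝒜 →ₗ[O] M) :
    ∃ ψ : A →ₗ[K] M, ∀ a : 𝒜, ψ a = φ a := by
  have : IsLocalizedModule (nonZeroDivisors O) 𝒜.val.toLinearMap :=
    { map_units := isUnit_algebraMap_end K A
      surj := fun a => by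
        obtain ⟨c, hc, hca⟩ := exists_smul_mem_of_span_eq_top h a
        exact ⟨(⟨c • a, hca⟩, ⟨c, mem_nonZeroDivisors_of_ne_zero hc⟩), rfl⟩
      exists_of_eq := fun {x y} hxy => ⟨1, by rw [Subtype.ext hxy]⟩ }
  exact ⟨(IsLocalizedModule.lift (nonZeroDivisors O) 𝒜.val.toLinearMap φ
    (isUnit_algebraMap_end K M)).extendScalarsOfIsLocalization (nonZeroDivisors O) K, fun a =>
      IsLocalizedModule.lift_apply (nonZeroDivisors O) 𝒜.val.toLinearMap φ
        (isUnit_algebraMap_end K M) a⟩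

end Denominators

section Brauer

open MulOpposite

variable {O K : Type*} [CommRing O] [IsDomain O] [Field K] [Algebra O K] [IsFractionRing O K]

/-- A Morita context between orders that span central simple algebras exhibits one of these
algebras as a corner of a matrix algebra over the other: if `∑ q (j k) (i k) = 1`, the embedding is
`b ↦ (p (i k b) (j l))`, with inverse `x ↦ ∑ q (j k x k l) (i l)`. -/
theorem MoritaContext.isBrauerEquivalent {A₁ A₂ : CSA K} [Algebra O A₁] [IsScalarTower O K A₁]
    [Algebra O A₂] [IsScalarTower O K A₂] {𝒜₁ : Subalgebra O A₁} {𝒜₂ : Subalgebra O A₂}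
    (h₁ : Submodule.span K (𝒜₁ : Set A₁) = ⊤) (h₂ : Submodule.span K (𝒜₂ : Set A₂) = ⊤)
    {I J : Type*} [AddCommGroup I] [Module O I] [Module 𝒜₁ I] [Module 𝒜₂ᵐᵒᵖ I] [AddCommGroup J]
    [Module O J] [Module 𝒜₂ J] [Module 𝒜₁ᵐᵒᵖ J] [IsScalarTower O 𝒜₂ᵐᵒᵖ I] [SMulCommClass 𝒜₁ 𝒜₂ᵐᵒᵖ I]
    (c : MoritaContext O 𝒜₁ 𝒜₂ I J) : IsBrauerEquivalent A₁ A₂ := by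
  obtain ⟨t, ht⟩ := c.q_unit
  obtain ⟨n, j, i, rfl⟩ := TensorProduct.exists_sum_tmul_eq t
  simp only [map_sum, TensorProduct.lift.tmul] at ht
  have hn : n ≠ 0 := by
    rintro rfl
    exact one_ne_zero (α := A₂) (congrArg Subtype.val ht).symm
  have : NeZero n := ⟨hn⟩
  let φ : 𝒜₂ →ₗ[O] Matrix (Fin n) (Fin n) A₁ :=
    { toFun := fun b => Matrix.of fun k l => (c.p (op b • i k) (j l) : A₁)
      map_add' := fun b b' => by ext k l; simp [add_smul]
      map_smul' := fun r b => by ext k l; simp [smul_assoc] }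
  have hφ : ∀ b k l, φ b k l = (c.p (op b • i k) (j l) : A₁) := fun _ _ _ => rfl
  have hpp : ∀ (b b' : 𝒜₂) k m,
      ∑ l, c.p (op b • i k) (j l) * c.p (op b' • i l) (j m) = c.p (op (b * b') • i k) (j m) := by
    intro b b' k m
    have (l : Fin n) : c.p (op b • i k) (j l) * c.p (op b' • i l) (j m) =
        c.p (op (b * (c.q (j l) (i l) * b')) • i k) (j m) := by
      rw [← c.p_smul, c.p_assoc, c.q_op_smul, op_mul b, mul_smul]
    rw [Finset.sum_congr rfl fun l _ => this l, ← LinearMap.sum_apply, ← map_sum,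
      ← Finset.sum_smul, ← Finset.op_sum, ← Finset.mul_sum, ← Finset.sum_mul, ht, one_mul]
  have hφmul : ∀ b b', φ (b * b') = φ b * φ b' := fun b b' => by
    ext k m
    rw [hφ, Matrix.mul_apply, ← hpp]
    simp [hφ]
  have hφinj : ∀ b, φ b = 0 → b = 0 := fun b hb => by
    have hp : ∀ k l, c.p (op b • i k) (j l) = 0 := fun k l =>
      Subtype.ext (congrFun (congrFun hb k) l)
    rw [← one_mul b, ← mul_one (1 * b), ← ht, Finset.sum_mul, Finset.sum_mul_sum]
    refine Finset.sum_eq_zero fun k _ => Finset.sum_eq_zero fun l _ => ?_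
    rw [← c.q_op_smul, ← c.q_op_smul, ← c.p_assoc, hp, zero_smul, map_zero]
  have hφcorner : ∀ (a : 𝒜₁) k l,
      φ (c.q (j k) (a • i l)) = φ 1 * Matrix.single k l (a : A₁) * φ 1 := by
    intro a k l
    ext m r
    rw [Matrix.mul_apply, Finset.sum_eq_single l, Matrix.mul_apply, Finset.sum_eq_single k,
      Matrix.single_apply_same, hφ, hφ, hφ]
    · rw [op_one, one_smul, one_smul, ← c.p_assoc, c.p_smul, c.p_smul, ← mul_assoc]
      rfl
    · intro k' _ hk
      rw [Matrix.single_apply_of_row_ne hk.symm, mul_zero]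
    · simp
    · intro l' _ hl
      rw [Matrix.mul_single_apply_of_ne _ _ _ _ _ hl, zero_mul]
    · simp
  obtain ⟨ψ, hψ⟩ := exists_linearMap_extend h₂ φ
  refine isBrauerEquivalent_of_corner hn ψ (fun x y => ?_) ?_ fun x => ?_
  · have e1 : ∀ b : 𝒜₂, ψ ∘ₗ LinearMap.mulLeft K (b : A₂) =
        LinearMap.mulLeft K (ψ b) ∘ₗ ψ := fun b => LinearMap.ext_on h₂ fun b' hb' => by
        change ψ (b * b') = ψ b * ψ b'
        have := hφmul b ⟨b', hb'⟩
        rwa [← hψ, ← hψ, ← hψ] at this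
    have e2 : ψ ∘ₗ LinearMap.mulRight K y = LinearMap.mulRight K (ψ y) ∘ₗ ψ :=
      LinearMap.ext_on h₂ fun b hb => LinearMap.congr_fun (e1 ⟨b, hb⟩) y
    exact LinearMap.congr_fun e2 x
  · refine (injective_iff_map_eq_zero ψ).2 fun a ha => ?_
    obtain ⟨r, hr, hra⟩ := exists_smul_mem_of_span_eq_top h₂ a
    refine smul_eq_zero_of_tower K hr (congrArg Subtype.val (hφinj ⟨r • a, hra⟩ ?_))
    rw [← hψ]
    change ψ (r • a) = 0
    rw [← algebraMap_smul K, map_smul, ha, smul_zero]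
  · have key : x ∈ (LinearMap.range ψ).comap
        (LinearMap.mulRight K (ψ 1) ∘ₗ LinearMap.mulLeft K (ψ 1)) := by
      induction x using Matrix.induction_on with
      | h_add x y hx hy => exact add_mem hx hy
      | h_std_basis k l a =>
        obtain ⟨r, hr, hra⟩ := exists_smul_mem_of_span_eq_top h₁ a
        have hrk : algebraMap O K r ≠ 0 := by
          simpa only [map_zero] using (FaithfulSMul.algebraMap_injective O K).ne hr
        refine (Submodule.smul_mem_iff _ hrk).1 ?_
        rw [Matrix.smul_single, algebraMap_smul]
        refine ⟨_, (hψ _).trans (hφcorner ⟨r • a, hra⟩ k l) |>.trans ?_⟩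
        rw [← hψ]
        rfl
    exact key

end Brauer

/-! ### Simple modules and their endomorphism rings -/

section SimpleModules

variable {O K A : Type*} [CommRing O] [IsDomain O] [Field K] [Algebra O K] [IsFractionRing O K]
  [Ring A] [Algebra O A] [Algebra K A] [IsScalarTower O K A] {𝒜 : Subalgebra O A}

theorem exists_smul_mem_of_fg (h : Submodule.span K (𝒜 : Set A) = ⊤) {V : Type*} [AddCommGroup V]
    [Module A V] (s : V →ₗ[A] A) {L : Submodule 𝒜 V} (hL : L.FG) :
    ∃ c : O, c ≠ 0 ∧ ∀ x ∈ L, c • s x ∈ 𝒜 := by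
  obtain ⟨T, rfl⟩ := hL
  choose d hd hdT using fun x => exists_smul_mem_of_span_eq_top h (s x)
  refine ⟨∏ t ∈ T, d t, Finset.prod_ne_zero_iff.2 fun t _ => hd t, fun x hx => ?_⟩
  induction hx using Submodule.span_induction with
  | mem x hx =>
    obtain ⟨r, hr⟩ := Finset.dvd_prod_of_mem d hx
    rw [hr, mul_comm, mul_smul]
    exact 𝒜.smul_mem (hdT x) r
  | zero => rw [map_zero, smul_zero]; exact zero_mem _
  | add x y _ _ hx hy => rw [map_add, smul_add]; exact add_mem hx hy
  | smul a x _ hx =>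
    rw [Subalgebra.smul_def, map_smul, smul_eq_mul, ← mul_smul_comm]
    exact mul_mem a.2 hx

/-- A simple module over a semisimple algebra is a lattice module for each hereditary order in this
algebra. -/
theorem IsHereditaryOrder.isLatticeModule (h : IsHereditaryOrder K 𝒜) [IsSemisimpleRing A]
    {V : Type*} [AddCommGroup V] [Module A V] [IsSimpleModule A V] [Module O V]
    [IsScalarTower O A V] [Module K V] [IsScalarTower O K V] {D : Type*} [DivisionRing D]
    [Module D V] (hD : ∀ f : V →ₗ[A] V, ∃ d : D, ∀ x, f x = d • x)
    (hV : ∃ (n : ℕ) (j : A →ₗ[A] (Fin n → V)), Function.Injective j) :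
    IsLatticeModule O 𝒜 D V := by
  have hsec : ∀ x : V, x ≠ 0 → ∃ s : V →ₗ[A] A, ∀ y, s y • x = y := fun x hx => by
    have := Module.projective_of_isSemisimpleRing A V
    obtain ⟨s, hs⟩ := Module.projective_lifting_property (LinearMap.toSpanSingleton A V x)
      LinearMap.id (IsSimpleModule.toSpanSingleton_surjective A hx)
    exact ⟨s, fun y => LinearMap.congr_fun hs y⟩
  have hO : ∀ (c : O) (a : A) (ha : c • a ∈ 𝒜) (v : V), (⟨c • a, ha⟩ : 𝒜) • v = c • a • v :=
    fun c a ha v => smul_assoc c a v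
  refine ⟨fun L hL => ?_, fun x hx v => ?_, fun L f => ?_, ?_⟩
  · have := IsSimpleModule.nontrivial A V
    obtain ⟨x, hx⟩ := exists_ne (0 : V)
    obtain ⟨s, hs⟩ := hsec x hx
    obtain ⟨c, hc, hcL⟩ := exists_smul_mem_of_fg h.span_eq_top s hL
    let g : L →ₗ[𝒜] 𝒜 :=
      { toFun := fun y => ⟨c • s y, hcL y y.2⟩
        map_add' := fun y z => Subtype.ext (by simp)
        map_smul' := fun a y => Subtype.ext (by simp [Subalgebra.smul_def]) }
    have hg : Function.Injective g := fun y z hyz => by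
      have h1 : c • s y = c • s z := congrArg Subtype.val hyz
      rw [← sub_eq_zero, ← smul_sub] at h1
      have h2 := sub_eq_zero.1 (smul_eq_zero_of_tower K hc h1)
      exact Subtype.ext (by rw [← hs y, h2, hs])
    have := h.projective_left_ideal (LinearMap.range g)
    exact Module.Projective.of_equiv (LinearEquiv.ofInjective g hg).symm
  · obtain ⟨s, hs⟩ := hsec x hx
    obtain ⟨c, hc, hcs⟩ := exists_smul_mem_of_span_eq_top h.span_eq_top (s v)
    exact ⟨c, hc, ⟨c • s v, hcs⟩, by rw [hO, hs]⟩
  · by_cases hL : ∀ x : L, (x : V) = 0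
    · refine ⟨0, fun x => ?_⟩
      rw [show x = 0 from Subtype.ext (hL x), map_zero, ZeroMemClass.coe_zero, smul_zero]
    · push Not at hL
      obtain ⟨x, hx⟩ := hL
      obtain ⟨s, hs⟩ := hsec x hx
      obtain ⟨d, hd⟩ := hD (LinearMap.toSpanSingleton A V (f x) ∘ₗ s)
      refine ⟨d, fun y => ?_⟩
      obtain ⟨c, hc, hcs⟩ := exists_smul_mem_of_span_eq_top h.span_eq_top (s y)
      have h1 : c • f y = c • s y • f x := by
        rw [← hO c _ hcs, ← map_smul f, ← LinearMap.map_smul_of_tower f c]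
        refine congrArg f (Subtype.ext ?_)
        change c • (y : V) = (⟨c • s y, hcs⟩ : 𝒜) • (x : V)
        rw [hO, hs]
      rw [← hd]
      rw [← sub_eq_zero, ← smul_sub] at h1
      exact sub_eq_zero.1 (smul_eq_zero_of_tower K hc h1)
  · obtain ⟨n, j, hj⟩ := hV
    let j' : 𝒜 →ₗ[𝒜] (Fin n → V) :=
      { toFun := fun a => j a
        map_add' := fun a b => map_add j (a : A) b
        map_smul' := fun a b => map_smul j (a : A) (b : A) }
    exact ⟨n, j', hj.comp Subtype.val_injective⟩

end SimpleModules

section EndomorphismRings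

variable {K : Type*} [Field K]

open Matrix.Module

theorem isSimpleModule_matrix {A V : Type*} [Ring A] [AddCommGroup V] [Module A V]
    [IsSimpleModule A V] (n : ℕ) [NeZero n] :
    IsSimpleModule (Matrix (Fin n) (Fin n) A) (Fin n → V) := by
  have := IsSimpleModule.nontrivial A V
  refine isSimpleModule_iff_toSpanSingleton_surjective.2 ⟨inferInstance, fun x hx y => ?_⟩
  obtain ⟨i, hi⟩ := Function.ne_iff.1 hx
  choose a ha using fun k => IsSimpleModule.toSpanSingleton_surjective A hi (y k)
  refine ⟨Matrix.of fun k l => if l = i then a k else 0, funext fun k => ?_⟩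
  rw [LinearMap.toSpanSingleton_apply, Matrix.Module.smul_apply, Finset.sum_eq_single i]
  · simpa using ha k
  · intro l _ hl
    simp [hl]
  · simp

/-- Morita invariance of endomorphism rings for the passage from `A` to a matrix ring over `A`. -/
theorem nonempty_algEquiv_end_matrix {A V : Type*} [Ring A] [Algebra K A] [AddCommGroup V]
    [Module A V] [Module K V] [IsScalarTower K A V] (n : ℕ) [NeZero n]
    [IsScalarTower K (Matrix (Fin n) (Fin n) A) (Fin n → V)] :
    Nonempty (Module.End A V ≃ₐ[K] Module.End (Matrix (Fin n) (Fin n) A) (Fin n → V)) := by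
  let g : Module.End A V →ₗ[K] Module.End (Matrix (Fin n) (Fin n) A) (Fin n → V) :=
    { toFun := fun f => f.mapMatrixModule (Fin n)
      map_add' := fun f f' => rfl
      map_smul' := fun k f => rfl }
  have hg : ∀ f v i, g f v i = f (v i) := fun _ _ _ => rfl
  refine ⟨AlgEquiv.ofBijective (AlgHom.ofLinearMap g rfl fun f f' => rfl) ⟨fun f f' hff => ?_,
    fun F => ?_⟩⟩
  · ext v
    exact congrFun (LinearMap.congr_fun hff fun _ => v) 0
  · refine ⟨{ toFun := fun v => F (Pi.single 0 v) 0, map_add' := ?_, map_smul' := ?_ }, ?_⟩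
    · intro v w
      rw [Pi.single_add, map_add, Pi.add_apply]
    · intro a v
      have : (Pi.single 0 (a • v) : Fin n → V) =
          (Matrix.single 0 0 a : Matrix (Fin n) (Fin n) A) • (Pi.single 0 v : Fin n → V) := by
        rw [single_smul, Pi.single_eq_same]
      rw [this, map_smul, single_smul, Pi.single_eq_same, RingHom.id_apply]
    · refine LinearMap.ext fun w => funext fun i => ?_
      change F (Pi.single 0 (w i)) 0 = F w i
      have : (Pi.single 0 (w i) : Fin n → V) =
          (Matrix.single 0 i 1 : Matrix (Fin n) (Fin n) A) • w := by
        rw [single_smul, one_smul]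
      rw [this, map_smul, single_smul, Pi.single_eq_same, one_smul]

/-- The endomorphism rings of simple modules over isomorphic simple Artinian rings are
isomorphic. -/
theorem nonempty_algEquiv_end_of_algEquiv {C C' W W' : Type*} [Ring C] [Algebra K C] [Ring C']
    [Algebra K C'] [IsSimpleRing C] [IsArtinianRing C] (φ : C ≃ₐ[K] C') [AddCommGroup W]
    [Module C W] [Module K W] [IsScalarTower K C W] [AddCommGroup W'] [Module C' W'] [Module K W']
    [IsScalarTower K C' W'] [IsSimpleModule C W] [IsSimpleModule C' W'] :
    Nonempty (Module.End C W ≃ₐ[K] Module.End C' W') := by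
  let : Module C W' := Module.compHom W' (φ : C →+* C')
  have hφ : ∀ (c : C) (x : W'), c • x = φ c • x := fun _ _ => rfl
  have : IsScalarTower K C W' := ⟨fun k c x => by rw [hφ, hφ, map_smul, smul_assoc]⟩
  have : IsSimpleModule C W' := by
    refine isSimpleModule_iff_toSpanSingleton_surjective.2
      ⟨IsSimpleModule.nontrivial C' W', fun x hx y => ?_⟩
    obtain ⟨c, hc⟩ := IsSimpleModule.toSpanSingleton_surjective C' hx y
    refine ⟨φ.symm c, ?_⟩
    rw [LinearMap.toSpanSingleton_apply, hφ, φ.apply_symm_apply]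
    exact hc
  obtain ⟨L, ⟨e⟩⟩ := IsSemisimpleRing.exists_linearEquiv_ideal_of_isSimpleModule C W
  obtain ⟨L', ⟨e'⟩⟩ := IsSemisimpleRing.exists_linearEquiv_ideal_of_isSimpleModule C W'
  have := IsSimpleModule.congr e.symm
  have := IsSimpleModule.congr e'.symm
  obtain ⟨u⟩ := IsSimpleRing.isIsotypic C C L' L
  let g : Module.End C W' →ₗ[K] Module.End C' W' :=
    { toFun := fun f =>
        { toFun := f
          map_add' := f.map_add
          map_smul' := fun c x => by
            have := f.map_smul (φ.symm c) x
            rwa [hφ, hφ, φ.apply_symm_apply] at this }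
      map_add' := fun _ _ => rfl
      map_smul' := fun _ _ => rfl }
  let g' : Module.End C W' ≃ₐ[K] Module.End C' W' :=
    AlgEquiv.ofBijective (AlgHom.ofLinearMap g rfl fun _ _ => rfl)
      ⟨fun f f' hff => LinearMap.ext fun x =>
        LinearMap.congr_fun (show g f = g f' from hff) x, fun F =>
        ⟨{ toFun := F, map_add' := F.map_add, map_smul' := fun c x => F.map_smul (φ c) x }, rfl⟩⟩
  exact ⟨(((e.trans u).trans e'.symm).conjAlgEquiv K).trans g'⟩

theorem nonempty_algEquiv_end_of_isBrauerEquivalent {A₁ A₂ : CSA K} (h : IsBrauerEquivalent A₁ A₂)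
    {V₁ V₂ : Type*} [AddCommGroup V₁] [Module A₁ V₁] [Module K V₁] [IsScalarTower K A₁ V₁]
    [IsSimpleModule A₁ V₁] [AddCommGroup V₂] [Module A₂ V₂] [Module K V₂] [IsScalarTower K A₂ V₂]
    [IsSimpleModule A₂ V₂] : Nonempty (Module.End A₁ V₁ ≃ₐ[K] Module.End A₂ V₂) := by
  obtain ⟨n, m, hn, hm, ⟨φ⟩⟩ := h
  have : NeZero n := ⟨hn⟩
  have : NeZero m := ⟨hm⟩
  have : IsArtinianRing (Matrix (Fin n) (Fin n) A₁) := IsArtinianRing.of_finite K _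
  have : IsScalarTower K (Matrix (Fin n) (Fin n) A₁) (Fin n → V₁) :=
    ⟨fun k N v => funext fun i => by simp [Finset.smul_sum]⟩
  have : IsScalarTower K (Matrix (Fin m) (Fin m) A₂) (Fin m → V₂) :=
    ⟨fun k N v => funext fun i => by simp [Finset.smul_sum]⟩
  have := isSimpleModule_matrix (A := A₁) (V := V₁) n
  have := isSimpleModule_matrix (A := A₂) (V := V₂) m
  obtain ⟨e₁⟩ := nonempty_algEquiv_end_matrix (K := K) (A := A₁) (V := V₁) n
  obtain ⟨e₂⟩ := nonempty_algEquiv_end_matrix (K := K) (A := A₂) (V := V₂) m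
  obtain ⟨e⟩ := nonempty_algEquiv_end_of_algEquiv φ (W := Fin n → V₁) (W' := Fin m → V₂)
  exact ⟨(e₁.trans e).trans e₂.symm⟩

end EndomorphismRings

/-! ### Hereditary orders -/

section Hereditary

theorem IsHereditaryOrder.finite {O K A : Type*} [CommRing O] [Field K] [Ring A] [Algebra O A]
    [Algebra K A] {𝒜 : Subalgebra O A} (h : IsHereditaryOrder K 𝒜) : Module.Finite O 𝒜 :=
  Module.Finite.iff_fg.2 h.fg

theorem faithfulSMul_end (O K : Type*) {A : Type*} [CommRing O] [Field K] [Algebra O K]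
    [FaithfulSMul O K] [Ring A] [Algebra O A] (V : Type*) [AddCommGroup V] [Nontrivial V]
    [Module A V] [Module O V] [IsScalarTower O A V] [Module K V] [IsScalarTower O K V] :
    FaithfulSMul O (Module.End A V) := by
  refine ⟨fun {c d} h => ?_⟩
  obtain ⟨v, hv⟩ := exists_ne (0 : V)
  have h1 : c • v = d • v := LinearMap.congr_fun (h 1) v
  rw [← sub_eq_zero, ← sub_smul] at h1
  by_contra hcd
  exact hv (smul_eq_zero_of_tower K (sub_ne_zero.2 hcd) h1)

variable {O K A : Type*} [CommRing O] [IsDomain O] [Field K] [Algebra O K] [IsFractionRing O K]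
  [Ring A] [Algebra O A] [Algebra K A] [IsScalarTower O K A] {𝒜 : Subalgebra O A}

theorem IsHereditaryOrder.exists_isIndex [IsDiscreteValuationRing O] [HenselianLocalRing O]
    [IsSimpleRing A] [IsArtinianRing A] (h : IsHereditaryOrder K 𝒜) {ϖ : O} (hϖ : Irreducible ϖ) :
    ∃ e, IsIndex 𝒜 ϖ e := by
  classical
  obtain ⟨n, hn, V, hV, ⟨j⟩⟩ := (IsSimpleRing.isIsotypic A A).linearEquiv_fun
  have := IsSimpleModule.nontrivial A V
  have := h.finite
  have := faithfulSMul_end O K (A := A) V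
  have hl : IsLatticeModule O 𝒜 (Module.End A V) V :=
    h.isLatticeModule (fun f => ⟨f, fun x => rfl⟩) ⟨n, j, j.injective⟩
  have : SMulCommClass (Module.End A V) 𝒜 V := ⟨fun f a x => map_smul f (a : A) x⟩
  exact hl.exists_isIndex hϖ

end Hereditary

end HereditaryOrders


theorem proposition1
    {O : Type u} [CommRing O] [IsDomain O] [IsDiscreteValuationRing O] [HenselianLocalRing O]
    {K : Type v} [Field K] [Algebra O K] [IsFractionRing O K]
    (ϖ : O) (hϖ : Irreducible ϖ)
    (A₁ A₂ : CSA.{v, w} K)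
    [Algebra O A₁] [IsScalarTower O K A₁] [Algebra O A₂] [IsScalarTower O K A₂]
    (𝒜₁ : Subalgebra O A₁) (𝒜₂ : Subalgebra O A₂)
    (h₁ : HereditaryOrders.IsHereditaryOrder K 𝒜₁)
    (h₂ : HereditaryOrders.IsHereditaryOrder K 𝒜₂) :
    HereditaryOrders.MoritaEquivalent O 𝒜₁ 𝒜₂ ↔
      IsBrauerEquivalent A₁ A₂ ∧
        ∃ e : ℕ, HereditaryOrders.IsIndex 𝒜₁ ϖ e ∧ HereditaryOrders.IsIndex 𝒜₂ ϖ e := by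
  classical
  have : IsArtinianRing A₁ := IsArtinianRing.of_finite K A₁
  have : IsArtinianRing A₂ := IsArtinianRing.of_finite K A₂
  constructor
  · rintro ⟨I, J, _, _, _, _, _, _, _, _, hI, hJ, hf, hg⟩
    obtain ⟨c⟩ := HereditaryOrders.exists_moritaContext hI hJ hf hg
    have := hI.left_compat
    have := hI.right_compat
    have := hI.comm
    have := hJ.left_compat
    have := hJ.comm
    obtain ⟨e₁, he₁⟩ := h₁.exists_isIndex hϖ
    obtain ⟨e₂, he₂⟩ := h₂.exists_isIndex hϖ
    exact ⟨c.isBrauerEquivalent h₁.span_eq_top h₂.span_eq_top, e₁, he₁, c.isIndex he₁ he₂⟩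
  · rintro ⟨hB, e, he₁, he₂⟩
    obtain ⟨n₁, hn₁, V₁, hV₁, ⟨j₁⟩⟩ := (IsSimpleRing.isIsotypic A₁ A₁).linearEquiv_fun
    obtain ⟨n₂, hn₂, V₂, hV₂, ⟨j₂⟩⟩ := (IsSimpleRing.isIsotypic A₂ A₂).linearEquiv_fun
    have := IsSimpleModule.nontrivial A₁ V₁
    have := IsSimpleModule.nontrivial A₂ V₂
    have := h₁.finite
    have := h₂.finite
    obtain ⟨σ⟩ :=
      HereditaryOrders.nonempty_algEquiv_end_of_isBrauerEquivalent hB (V₁ := V₁) (V₂ := V₂)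
    let D := Module.End A₁ V₁
    have : FaithfulSMul O D := HereditaryOrders.faithfulSMul_end O K (A := A₁) V₁
    let _ : Module D V₂ := Module.compHom V₂ (σ : Module.End A₁ V₁ →+* Module.End A₂ V₂)
    have hσ : ∀ (d : D) (x : V₂), d • x = σ d x := fun _ _ => rfl
    have : SMulCommClass D 𝒜₁ V₁ := ⟨fun f a x => map_smul f (a : A₁) x⟩
    have : SMulCommClass D 𝒜₂ V₂ := ⟨fun f a x => map_smul (σ f) (a : A₂) x⟩
    have : IsScalarTower O D V₂ := ⟨fun r d x => by
      rw [hσ, hσ, ← algebraMap_smul K r d, map_smul, algebraMap_smul]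
      rfl⟩
    have l₁ : HereditaryOrders.IsLatticeModule O 𝒜₁ D V₁ :=
      h₁.isLatticeModule (fun f => ⟨f, fun x => rfl⟩) ⟨n₁, j₁, j₁.injective⟩
    have l₂ : HereditaryOrders.IsLatticeModule O 𝒜₂ D V₂ :=
      h₂.isLatticeModule (fun f => ⟨σ.symm f, fun x => by rw [hσ, σ.apply_symm_apply]⟩)
        ⟨n₂, j₂, j₂.injective⟩
    exact l₁.moritaEquivalent l₂ hϖ he₁ he₂
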